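/- **Tie sequences.** A tie move is one of $L_i,L_o,R_i,R_o,C_i,C_o$ (the region Left, Right or Center that the active strand enters, and the direction: $i$ = in, over the passive strand; $o$ = out, under it). A tie sequence is a list of at most $9$ tie moves followed by the tuck $T$, such that the first move is $L_i$ or $L_o$, consecutive moves have different regions and different directions, and the last three moves are $L_oR_iC_o$ or $R_oL_iC_o$. (There are 85 of them.) **Tie knots.** The passive strand runs from $b$ up the straight strand and then clockwise around the neck loop to $a$. Below the neck loop the straight strand separates $L$ (on its left) from $R$; the neck loop separates $C$ (its inside) from $L$ (along its left half) and from $R$ (along its right half). The active strand starts at $a$ on the right and performs the moves in order, crossing the straight strand when it passes between $L$ and $R$ (so the first move is the top crossing of the straight strand and closes the neck loop), and crossing the left (right) half of the neck loop when it passes between $C$ and $L$ (between $C$ and $R$). Crossings on the straight strand appear in downward order, and crossings on each half of the neck loop in upward order. The tuck $T$ produces three crossings $t_1,t_2,t_3$: after the last move $C_o$ the active strand crosses over the neck loop ($t_1$) on the side entered by the third move from the end; then it crosses over ($t_2$) and under ($t_3$) the arc of the active strand between the third-to-last and the second-to-last move, entering and leaving the region bounded by that arc, $t_2$ being the crossing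 nearer to the third-to-last move. Finally it is joined to $b$. The resulting diagram is the diagram of the tie knot. Knots are given by diagrams on the sphere; two diagrams represent the same knot if they are related by finitely many Reidemeister moves and isotopies. For $n\ge 1$ the twist knot $T_n$ is the knot with an alternating diagram consisting of a row of $n$ half twists of two strands and a clasp of two further crossings; for odd $p\ge 3$ the $(2,p)$ torus knot is the closure of $p$ half twists of two strands, all of the same handedness. In both cases mirror images are included. **Reductions.** Here $[\dots]$ is any (possibly empty) list of moves, and $f(L,R)$ is any alternating list of left and right moves (non-empty in (IV)): (0) $L_oR_iC_oT\to\emptyset$; (I) $[\dots]L_iR_oL_iC_oT\to[\dots]L_iC_ot_1$ and $[\dots]R_iL_oR_iC_oT\to[\dots]R_iC_ot_1$; (II) $[\dots]C_iR_oL_iC_oT\to[\dots]$ and $[\dots]C_iL_oR_iC_oT\to[\dots]$; (III) $f(L,R)\to\emptyset$; (IV) $[\dots]C\,f(L,R)\to[\dots]C\,s$, where $s$ is the first move of $f(L,R)$ and $C$ is $C_i$ or $C_o$. A tie sequence reduces to a word if the word is obtained from it by finitely many reductions. Below, $\ast$ stands for an $L$ move, an $R$ move, or $t_1$; directions are omitted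 and may be arbitrary; the length of a word is its number of letters, $\ast$ included; all parenthesised repetitions may be empty. **Theorem.** Let $w$ be a tie sequence and $K$ its tie knot. 1. $K$ is a twist knot $T_n$ for some $n\ge 1$ if and only if $w$ reduces to a word of one of the types - type 1: $g(L,R)\,C\,\ast$, where $g(L,R)$ is a non-empty alternating sequence of left and right moves that starts with a left move, - type 2: $LRC(RC\dots RC)\ast$, - type 3: $LC(RC\dots RC)\ast$. More precisely, for every $n\ge 1$, $K$ is the twist knot $T_n$ if and only if $w$ reduces to a word of length $n+2$ that is of type 1, or of type 2 with $n$ even, or of type 3 with $n$ odd. 2. For every odd $p\ge 3$, $K$ is the $(2,p)$ torus knot if and only if $w$ reduces to a word of length $p$ of the form $LC(LC\dots LC)\ast$. -/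

import Mathlib

namespace TieKnot

/-! ### Knot diagrams -/

/-- The pieces from which diagrams are assembled. `X a b c d` is a crossing whose four ends, read
counterclockwise, lie on the edges labelled `a, b, c, d`; the strand through `a` and `c` passes
under the strand through `b` and `d`. `P a b` is a marked point on a strand without crossing,
where the edge `a` meets the edge `b`. -/
inductive Node where
  | X (a b c d : ℕ)
  | P (a b : ℕ)
  deriving DecidableEq

/-- The labels at the ends of a piece, counterclockwise. -/
def Node.ends : Node → List ℕ
  | .X a b c d => [a, b, c, d]
  | .P a b => [a, b]

/-- Change the edge labels of a piece. -/
def Node.relabel (f : ℕ → ℕ) : Node → Node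
  | .X a b c d => .X (f a) (f b) (f c) (f d)
  | .P a b => .P (f a) (f b)

/-- Exchange the over and the under strand. -/
def Node.mirror : Node → Node
  | .X a b c d => .X b c d a
  | .P a b => .P a b

/-- A planar diagram code: the list of the pieces of a diagram. -/
abbrev PDCode := List Node

/-- The mirror image: all crossings are switched. -/
def PDCode.mirror (D : PDCode) : PDCode := D.map Node.mirror

/-- The ends of the pieces of a diagram. -/
def PDCode.Dart (D : PDCode) : Type :=
  Σ i : Fin D.length, Fin (D.get i).ends.length

/-- The label of the edge on which an end lies. -/
def PDCode.label (D : PDCode) (x : D.Dart) : ℕ := (D.get x.1).ends.get x.2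

/-- The end found `k` steps further counterclockwise at the same piece. -/
def PDCode.turn (D : PDCode) (k : ℕ) (x : D.Dart) : D.Dart :=
  ⟨x.1, ⟨(x.2.val + k) % (D.get x.1).ends.length,
    Nat.mod_lt _ (Nat.lt_of_le_of_lt (Nat.zero_le _) x.2.isLt)⟩⟩

/-- Two ends are joined by an edge. -/
def PDCode.Joined (D : PDCode) (x y : D.Dart) : Prop := x ≠ y ∧ D.label x = D.label y

/-- Moving along the knot: along an edge, or straight through a piece. -/
def PDCode.StrandStep (D : PDCode) (x y : D.Dart) : Prop :=
  D.Joined x y ∨ y = D.turn ((D.get x.1).ends.length / 2) x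

/-- Moving along the boundary of a face: along an edge, then to the neighbouring end. -/
def PDCode.FaceStep (D : PDCode) (x y : D.Dart) : Prop :=
  ∃ z, D.Joined x z ∧ y = D.turn 1 z

/-- `D` is a diagram of a knot on the sphere: every edge has exactly two ends, there is exactly
one component, and the Euler characteristic `V - E + F` equals `2`, where twice the number `E` of
edges is the number of ends. -/
structure PDCode.IsKnotDiagram (D : PDCode) : Prop where
  edges : ∀ x : D.Dart, ∃! y : D.Dart, D.Joined x y
  one_component : Nat.card (Quot D.StrandStep) = 1
  planar : 2 * D.length + 2 * Nat.card (Quot D.FaceStep) = Nat.card D.Dart + 4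

/-- The elementary moves between codes. The first five only change the code of a diagram: order of
the pieces, names of the edges, the end at which a piece is read off, marked points. The others
are the Reidemeister moves. -/
inductive Move : PDCode → PDCode → Prop
  | reorder {D D' : PDCode} (h : D.Perm D') : Move D D'
  | rename (D : PDCode) (f : ℕ → ℕ) (hf : Function.Injective f) :
      Move D (D.map (Node.relabel f))
  | turnX (D : PDCode) (a b c d : ℕ) : Move (.X a b c d :: D) (.X c d a b :: D)
  | turnP (D : PDCode) (a b : ℕ) : Move (.P a b :: D) (.P b a :: D)
  | unmark (D : PDCode) (a b : ℕ) (hab : a ≠ b) :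
      Move (.P a b :: D) (D.map (Node.relabel fun x => if x = b then a else x))
  | r1 (D : PDCode) (a b c : ℕ) : Move (.X a a b c :: D) (.P b c :: D)
  | r1_switched (D : PDCode) (a b c : ℕ) : Move (.X b a a c :: D) (.P b c :: D)
  | r2 (D : PDCode) (a b e f g h : ℕ) :
      Move (.X a b e f :: .X a g h b :: D) (.P e h :: .P f g :: D)
  | r3 (D : PDCode) (u₀ u₁ u₂ x₀ x₁ x₂ y₀ y₁ y₂ : ℕ) :
      Move (.X u₀ u₂ x₀ y₂ :: .X y₀ u₁ u₀ x₁ :: .X y₁ u₂ u₁ x₂ :: D)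
        (.X y₀ x₂ u₀ u₂ :: .X u₀ y₁ x₀ u₁ :: .X u₁ y₂ x₁ u₂ :: D)
  | r3_switched (D : PDCode) (u₀ u₁ u₂ x₀ x₁ x₂ y₀ y₁ y₂ : ℕ) :
      Move (.X u₀ u₂ x₀ y₂ :: .X u₁ u₀ x₁ y₀ :: .X y₁ u₂ u₁ x₂ :: D)
        (.X y₀ x₂ u₀ u₂ :: .X y₁ x₀ u₁ u₀ :: .X u₁ y₂ x₁ u₂ :: D)

/-- Two diagrams represent the same knot: they are related by a finite sequence of Reidemeister
moves through knot diagrams. -/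
def SameKnot : PDCode → PDCode → Prop :=
  Relation.EqvGen fun D D' => D.IsKnotDiagram ∧ D'.IsKnotDiagram ∧ Move D D'

/-- The standard diagram of the twist knot `T n`, for `1 ≤ n`. The crossings `0, …, n - 1` form a
horizontal row of `n` half twists of two strands (the four ends of a crossing are its NE, NW, SW,
SE ends, in this order); the last two crossings form the clasp above the row. The diagram is
alternating: every edge goes from an under to an over passage. -/
def twistDiagram (n : ℕ) : PDCode :=
  (List.range n).map (fun k => .X (2 * k + 2) (2 * k) (2 * k + 1) (2 * k + 3)) ++
    [.X (2 * n + 1) 1 (2 * n + 3) (2 * n + 2), .X (2 * n + 2) (2 * n + 3) 0 (2 * n)]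

/-- The standard diagram of the `(2, p)` torus knot, for odd `p`: two strands twisted around each
other with `p` crossings in a row, closed up around the core of the torus. -/
def torusDiagram (p : ℕ) : PDCode :=
  (List.range p).map fun k =>
    .X ((2 * k + 2) % (2 * p)) (2 * k) (2 * k + 1) ((2 * k + 3) % (2 * p))

/-- `D` represents the twist knot with `n` twists, of either handedness. -/
def IsTwistKnotWith (n : ℕ) (D : PDCode) : Prop :=
  SameKnot D (twistDiagram n) ∨ SameKnot D (twistDiagram n).mirror

/-- `D` represents a twist knot. -/
def IsTwistKnot (D : PDCode) : Prop := ∃ n, 1 ≤ n ∧ IsTwistKnotWith n D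

/-- `D` represents the `(2, p)` torus knot, of either handedness. -/
def IsTorusKnotTwo (p : ℕ) (D : PDCode) : Prop :=
  SameKnot D (torusDiagram p) ∨ SameKnot D (torusDiagram p).mirror

/-! ### Tie sequences and their diagrams -/

/-- The regions left, right, and centre. -/
inductive Region where
  | L | R | C
  deriving DecidableEq

/-- In-moves (over the passive strand) and out-moves (under the passive strand). -/
inductive Dir where
  | inward | outward
  deriving DecidableEq

/-- A tie move: the region that is entered, and the direction. -/
abbrev TieMove := Region × Dir

def Li : TieMove := (.L, .inward)
def Lo : TieMove := (.L, .outward)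
def Ri : TieMove := (.R, .inward)
def Ro : TieMove := (.R, .outward)
def Ci : TieMove := (.C, .inward)
def Co : TieMove := (.C, .outward)

/-- The tie moves of a tie sequence; the final tuck `T` is left out of the list. -/
structure IsTieSequence (m : List TieMove) : Prop where
  starts : m.head? = some Li ∨ m.head? = some Lo
  regions : m.IsChain (fun s t => s.1 ≠ t.1)
  directions : m.IsChain (fun s t => s.2 ≠ t.2)
  ends : [Lo, Ri, Co] <:+ m ∨ [Ro, Li, Co] <:+ m
  short : m.length ≤ 9

/-- The side on which the strand of the tuck comes down: it is the side of the loop through which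
it is threaded, that is, the region entered by the third move from the end. -/
def tuckSide (m : List TieMove) : Region := (m.getD (m.length - 3) Li).1

/-- The tie moves, followed by the first crossing of the tuck, which is an in-move. -/
def movesAndTuck (m : List TieMove) : List TieMove := m ++ [(tuckSide m, .inward)]

/-- The region entered by move number `j`, counted from `0`. -/
def target (m : List TieMove) (j : ℕ) : Region := ((movesAndTuck m).getD j Li).1

/-- The region left by move number `j`; the active strand starts on the right. -/
def source (m : List TieMove) (j : ℕ) : Region := if j = 0 then .R else target m (j - 1)

/-- Numbers of the crossings of the active strand with the straight strand, the border between
the regions `L` and `R`. -/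
def straightCrossings (m : List TieMove) : List ℕ :=
  (List.range (m.length + 1)).filter fun j => source m j ≠ .C ∧ target m j ≠ .C

/-- Numbers of the crossings of the active strand with the part of the neck loop between the
region `r` and the region `C`. -/
def neckCrossings (m : List TieMove) (r : Region) : List ℕ :=
  (List.range (m.length + 1)).filter fun j =>
    (source m j = r ∧ target m j = .C) ∨ (source m j = .C ∧ target m j = r)

/-- The two strands at a crossing. At a crossing given by a move, and at the first crossing of the
tuck, the passive strand is `crossed` and the active strand is `crossing`. At the last two
crossings of the tuck, the strand of the tuck is `crossing` and the loop through which it is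
threaded is `crossed`. -/
inductive Passage where
  | crossed | crossing
  deriving DecidableEq

/-- The passages met on a journey along the tie knot. If there are `k` moves, the crossings are
numbered as follows: `0, …, k - 1` for the moves, and `k`, `k + 1`, `k + 2` for the tuck.
The active strand comes first; between the moves `k - 3` and `k - 2` it forms the loop that is
crossed twice by the tuck. Then follow the straight strand, upwards, from the last to the first
crossing; the left half of the neck loop, upwards, from the first to the last crossing;
the right half of the neck loop, downwards, from the last to the first crossing. -/
def journey (m : List TieMove) : List (ℕ × Passage) :=
  let k := m.length
  (List.range (k - 2)).map (fun j => (j, .crossing)) ++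
    [(k + 1, .crossed), (k + 2, .crossed)] ++
    [(k - 2, .crossing), (k - 1, .crossing),
      (k, .crossing), (k + 1, .crossing), (k + 2, .crossing)] ++
    (straightCrossings m).reverse.map (fun j => (j, .crossed)) ++
    (neckCrossings m .L).map (fun j => (j, .crossed)) ++
    (neckCrossings m .R).reverse.map (fun j => (j, .crossed))

/-- At crossing `j`, does the strand `crossing` go over the strand `crossed`? -/
def goesOver (m : List TieMove) (j : ℕ) : Prop :=
  if j ≤ m.length then ((movesAndTuck m).getD j Li).2 = .inward else j = m.length + 1

instance (m : List TieMove) (j : ℕ) : Decidable (goesOver m j) := by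
  unfold goesOver; infer_instance

/-- At crossing `j`, does the strand `crossing` go from the left to the right of the strand
`crossed`? The straight strand, directed upwards, has `L` on its left and `R` on its right; the
neck loop, directed clockwise, has `C` on its right. The loop crossed by the tuck runs clockwise
around its inside if it is on the right side, and counterclockwise if it is on the left side; the
tuck enters it at `k + 1` and leaves it at `k + 2`. -/
def leftToRight (m : List TieMove) (j : ℕ) : Prop :=
  if j ≤ m.length then target m j = .C ∨ (source m j = .L ∧ target m j = .R)
  else (j = m.length + 1 ↔ tuckSide m = .R)

instance (m : List TieMove) (j : ℕ) : Decidable (leftToRight m j) := by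
  unfold leftToRight; infer_instance

/-- The crossing number `j` of the tie diagram. The edge that leads to the passage at place `s` of
the journey is labelled `s`. -/
def tieCrossing (m : List TieMove) (j : ℕ) : Node :=
  let s := (journey m).idxOf (j, Passage.crossed)
  let t := (journey m).idxOf (j, Passage.crossing)
  let s' := (s + 1) % (journey m).length
  let t' := (t + 1) % (journey m).length
  if goesOver m j then
    if leftToRight m j then .X s' t s t' else .X s' t' s t
  else
    if leftToRight m j then .X t s t' s' else .X t' s t s'

/-- The diagram of the tie knot with the given moves, closed up by joining the two ends of the
tie. -/
def tieDiagram (m : List TieMove) : PDCode :=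
  (List.range (m.length + 3)).map (tieCrossing m)

/-! ### Reduction of tie sequences -/

/-- The letters of tie sequences and reduced tie sequences: tie moves, the tuck `T`, and the
first crossing `t₁` of the tuck. -/
inductive Letter where
  | move (s : TieMove)
  | T
  | t₁
  deriving DecidableEq

/-- The word of a tie sequence, with its final tuck. -/
def tieWord (m : List TieMove) : List Letter := m.map Letter.move ++ [Letter.T]

/-- A sequence of alternating left and right moves. -/
def IsAlternatingLR (f : List TieMove) : Prop :=
  (∀ s ∈ f, s.1 ≠ .C) ∧ f.IsChain (fun s t => s.1 ≠ t.1)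

/-- The reductions of tie sequences. -/
inductive Reduction : List Letter → List Letter → Prop
  | zero : Reduction (tieWord [Lo, Ri, Co]) []
  | one_left (u : List TieMove) :
      Reduction (tieWord (u ++ [Li, Ro, Li, Co])) ((u ++ [Li, Co]).map .move ++ [.t₁])
  | one_right (u : List TieMove) :
      Reduction (tieWord (u ++ [Ri, Lo, Ri, Co])) ((u ++ [Ri, Co]).map .move ++ [.t₁])
  | two_left (u : List TieMove) :
      Reduction (tieWord (u ++ [Ci, Ro, Li, Co])) (u.map .move)
  | two_right (u : List TieMove) :
      Reduction (tieWord (u ++ [Ci, Lo, Ri, Co])) (u.map .move)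
  | three (f : List TieMove) (hf : IsAlternatingLR f) : Reduction (f.map .move) []
  | four (u : List TieMove) (c s : TieMove) (f : List TieMove) (hc : c.1 = .C)
      (hf : IsAlternatingLR (s :: f)) :
      Reduction ((u ++ c :: s :: f).map .move) ((u ++ [c, s]).map .move)

/-- The tie sequence `w` reduces to `v` by finitely many reductions. -/
def ReducesTo : List Letter → List Letter → Prop := Relation.ReflTransGen Reduction

/-- `v` consists of moves into the regions `r`, in any directions, followed by one more letter
`∗`, which is an `L` move, an `R` move, or `t₁`. -/
def HasForm (r : List Region) (v : List Letter) : Prop :=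
  ∃ (u : List TieMove) (star : Letter), v = u.map .move ++ [star] ∧ u.map Prod.fst = r ∧
    (star = .t₁ ∨ ∃ d, star = .move (.L, d) ∨ star = .move (.R, d))

/-- The alternating sequence `L, R, L, R, …` of length `n`. -/
def alternatingLR (n : ℕ) : List Region :=
  (List.range n).map fun j => if Even j then .L else .R

/-- The sequence `r, s, r, s, …, r, s` with `k` repetitions of `r, s`. -/
def repeatPair (r s : Region) (k : ℕ) : List Region := (List.replicate k [r, s]).flatten

/-- `v` is of the form `g(L,R) C ∗`, where `g(L,R)` is an alternating sequence of left and right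
moves that starts with a left move. -/
def IsType1 (v : List Letter) : Prop := ∃ n, 1 ≤ n ∧ HasForm (alternatingLR n ++ [.C]) v

/-- `v` is of the form `L R C (R C … R C) ∗`. -/
def IsType2 (v : List Letter) : Prop := ∃ k, HasForm ([.L, .R, .C] ++ repeatPair .R .C k) v

/-- `v` is of the form `L C (R C … R C) ∗`. -/
def IsType3 (v : List Letter) : Prop := ∃ k, HasForm ([.L, .C] ++ repeatPair .R .C k) v

/-- `v` is of the form `L C (L C … L C) ∗`. -/
def IsTorusType (v : List Letter) : Prop := ∃ k, HasForm ([.L, .C] ++ repeatPair .L .C k) v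

end TieKnot

/-!
There are 85 tie sequences, so the theorem is a finite statement once two things are available: a
computable quantity that distinguishes knots, and a way to produce sequences of Reidemeister moves
that identify knots.

*Distinguishing.* The Kauffman bracket with loop value `3` is a state sum over colourings of the
edges by three colours (`partition`), in which a crossing is the difference of its two smoothings,
with coefficients `1` and `-u`, where `u ^ 2 = 3 * u - 1`. In this form labels need not be
distinguished as inner or outer, and the Reidemeister moves become identities between weights,
averaged over the colours of the labels that disappear (`partition_r1`, `partition_r2`,
`partition_triangle`). The moves multiply the state sum by units `±u ^ k`, and the mirror image
conjugates it up to such a unit. The norm of the state sum from `ℤ[u]` to `ℤ` (`invariant`) is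
therefore an integer that depends only on the knot up to mirror image (`SameKnot.invariant_eq`,
`invariant_mirror`). The skein relation computes it for each diagram (`invariant_eq_bracketNorm`).
On twist knots and on `(2, p)` torus knots it satisfies linear recurrences (`twistNorm`,
`torusNorm`) and grows exponentially (`le_abs_twistNorm`, `le_abs_torusNorm`), so that for a given
tie knot only finitely many twist knots and torus knots have to be excluded.

*Identifying.* `simplify` searches for Reidemeister moves that remove crossings, if necessary after
a third Reidemeister move. A diagram counts as a knot diagram after a test with certificates for
the cyclic order along the strand and around the faces (`isKnotDiagram_of_isKnot`), so its results
are known to represent the same knot (`sameKnot_simplify`). For each tie knot that is to be a twist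
knot or a torus knot, the result is the standard diagram or its mirror image, up to the names of
the edges and the order of the crossings (`sameKnot_of_sameDiagramUpToMirror`).

*Words.* Every reduction that changes a word shortens it, so the finitely many words to which a tie
sequence reduces can be listed (`mem_reducedWords`), and the types of words are decidable.

The evaluation of these tests for all tie sequences (`IsTieSequence.verify`) shows that the knots
with a word of the right type and length are the claimed ones, and that all others have a different
invariant.
-/

namespace TieKnot

/-! ### The partition function of a diagram -/

section Average

variable {K : Type*} [Field K]

/-- The average of `G` over the three colours of the label `a`. -/
def avg (a : ℕ) (G : (ℕ → Fin 3) → K) (f : ℕ → Fin 3) : K :=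
  (∑ x, G (Function.update f a x)) / 3

/-- The average of `G` over the colours of all labels in the list `l`. Averages over different
labels commute and averaging twice over a label is the same as averaging once, so only the set of
labels in `l` matters. -/
def avgs (l : List ℕ) (G : (ℕ → Fin 3) → K) : (ℕ → Fin 3) → K := l.foldr avg G

@[simp] lemma avgs_nil (G : (ℕ → Fin 3) → K) : avgs [] G = G := rfl

@[simp] lemma avgs_cons (a : ℕ) (l : List ℕ) (G : (ℕ → Fin 3) → K) :
    avgs (a :: l) G = avg a (avgs l G) := rfl

lemma avg_mul_const (a : ℕ) (c : K) (G : (ℕ → Fin 3) → K) :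
    avg a (fun f => c * G f) = fun f => c * avg a G f := by
  funext f
  simp only [avg, ← Finset.mul_sum, mul_div_assoc]

lemma avgs_mul_const (l : List ℕ) (c : K) (G : (ℕ → Fin 3) → K) :
    avgs l (fun f => c * G f) = fun f => c * avgs l G f := by
  induction l with
  | nil => rfl
  | cons a l ih => rw [avgs_cons, ih, avg_mul_const]; rfl

lemma avgs_sub (l : List ℕ) (G H : (ℕ → Fin 3) → K) :
    avgs l (fun f => G f - H f) = fun f => avgs l G f - avgs l H f := by
  induction l with
  | nil => rfl
  | cons a l ih =>
    rw [avgs_cons, ih]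
    funext f
    simp only [avg, Finset.sum_sub_distrib, sub_div, avgs_cons]

lemma avg_comm (a b : ℕ) (G : (ℕ → Fin 3) → K) : avg a (avg b G) = avg b (avg a G) := by
  rcases eq_or_ne a b with rfl | h
  · rfl
  funext f
  simp only [avg, ← Finset.sum_div]
  rw [Finset.sum_comm]
  simp only [Function.update_comm h]

lemma avg_avgs_comm (a : ℕ) (l : List ℕ) (G : (ℕ → Fin 3) → K) :
    avg a (avgs l G) = avgs l (avg a G) := by
  induction l with
  | nil => rfl
  | cons b l ih => rw [avgs_cons, avgs_cons, avg_comm, ih]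

lemma avgs_comm (k l : List ℕ) (G : (ℕ → Fin 3) → K) : avgs k (avgs l G) = avgs l (avgs k G) := by
  induction k with
  | nil => rfl
  | cons a k ih => rw [avgs_cons, avgs_cons, ih, avg_avgs_comm]

/-- Renaming the labels by an injective map commutes with averaging. -/
lemma avgs_map (g : ℕ → ℕ) (hg : Function.Injective g) (l : List ℕ) (G : (ℕ → Fin 3) → K) :
    avgs (l.map g) (fun f => G (f ∘ g)) = fun f => avgs l G (f ∘ g) := by
  induction l with
  | nil => rfl
  | cons a l ih =>
    rw [List.map_cons, avgs_cons, ih]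
    funext f
    simp only [avg, Function.update_comp_eq_of_injective f hg, avgs_cons]

lemma dependsOn_avg {G : (ℕ → Fin 3) → K} {s : Set ℕ} (hG : DependsOn G s) (a : ℕ) :
    DependsOn (avg a G) (s \ {a}) := by
  intro f g h
  unfold avg
  congr 1
  refine Finset.sum_congr rfl fun x _ => hG fun i hi => ?_
  rcases eq_or_ne i a with rfl | hia
  · simp
  · simpa [hia] using h i ⟨hi, hia⟩

lemma dependsOn_avgs {G : (ℕ → Fin 3) → K} {s : Set ℕ} (hG : DependsOn G s) (l : List ℕ) :
    DependsOn (avgs l G) {i ∈ s | i ∉ l} := by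
  induction l with
  | nil => simpa using hG
  | cons a l ih =>
    refine (dependsOn_avg ih a).mono fun i hi => ?_
    simp_all

variable [CharZero K]

lemma avg_eq_self {G : (ℕ → Fin 3) → K} {s : Set ℕ} (hG : DependsOn G s) {a : ℕ} (ha : a ∉ s) :
    avg a G = G := by
  funext f
  have (x : Fin 3) : G (Function.update f a x) = G f :=
    hG fun i hi => Function.update_of_ne (ne_of_mem_of_not_mem hi ha) _ _
  simp [avg, this]

lemma avg_avg_self (a : ℕ) (G : (ℕ → Fin 3) → K) : avg a (avg a G) = avg a G :=
  avg_eq_self (dependsOn_avg (dependsOn_univ G) a) (by simp)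

lemma avgs_avg_of_mem {a : ℕ} {l : List ℕ} (h : a ∈ l) (G : (ℕ → Fin 3) → K) :
    avgs l (avg a G) = avgs l G := by
  induction l with
  | nil => simp at h
  | cons b l ih =>
    rcases List.mem_cons.1 h with rfl | h
    · rw [avgs_cons, ← avg_avgs_comm, avg_avg_self, avgs_cons]
    · rw [avgs_cons, ih h, avgs_cons]

lemma avgs_avgs_of_subset {k l : List ℕ} (h : k ⊆ l) (G : (ℕ → Fin 3) → K) :
    avgs l (avgs k G) = avgs l G := by
  induction k with
  | nil => rfl
  | cons a k ih =>
    rw [avgs_cons, avgs_avg_of_mem (h List.mem_cons_self),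
      ih fun x hx => h (List.mem_cons_of_mem _ hx)]

/-- Once all labels on which `G` depends are averaged over, the result is a constant, and the same
for every such list of labels. -/
lemma avgs_congr_of_subset {G : (ℕ → Fin 3) → K} {s : List ℕ} (hG : DependsOn G {i | i ∈ s})
    {k l : List ℕ} (hk : s ⊆ k) (hl : s ⊆ l) (f g : ℕ → Fin 3) : avgs k G f = avgs l G g := by
  have hc {k : List ℕ} (hk : s ⊆ k) : DependsOn (avgs k G) ∅ :=
    (dependsOn_avgs hG k).mono fun i hi => hi.2 (hk hi.1)
  have hconst {k : List ℕ} (hk : s ⊆ k) (m : List ℕ) : avgs m (avgs k G) = avgs k G := by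
    induction m with
    | nil => rfl
    | cons a m ih => rw [avgs_cons, ih, avg_eq_self (hc hk) (by simp)]
  have : avgs k G = avgs l G := by rw [← hconst hk l, avgs_comm, hconst hl k]
  rw [this]
  exact hc hl (by simp)

end Average

section PartitionFunction

variable {K : Type*} [Field K]

/-- The Kronecker delta on colours. -/
def delta (i j : Fin 3) : K := if i = j then 1 else 0

lemma delta_comm (i j : Fin 3) : (delta i j : K) = delta j i := by simp [delta, eq_comm]

@[simp] lemma delta_self (i : Fin 3) : (delta i i : K) = 1 := by simp [delta]

/-- The Boltzmann weight of a crossing whose ends have the colours `i, j, k, l`: the sum of the two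
smoothings with coefficients `1` and `-v`. Each end contributes a factor `√3`, which turns the
average over the colours of an edge into a sum. -/
def crossingWeight (v : K) (i j k l : Fin 3) : K :=
  9 * (delta i j * delta k l - v * (delta i l * delta j k))

/-- The weight of a piece under a colouring of the labels. -/
def Node.weight (v : K) (f : ℕ → Fin 3) : Node → K
  | .X a b c d => crossingWeight v (f a) (f b) (f c) (f d)
  | .P a b => 3 * delta (f a) (f b)

/-- The product of the weights of the pieces. -/
def PDCode.weight (v : K) (D : PDCode) (f : ℕ → Fin 3) : K := (D.map (Node.weight v f)).prod

/-- The labels of a diagram, with repetitions. -/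
def PDCode.labels (D : PDCode) : List ℕ := D.flatMap Node.ends

/-- The partition function of a diagram: the sum over all colourings of the edges by three colours
of the product of the weights. It is the Kauffman bracket with loop value `3`. -/
def partition (v : K) (D : PDCode) : K := avgs D.labels (D.weight v) 0

@[simp] lemma PDCode.weight_nil (v : K) (f : ℕ → Fin 3) : PDCode.weight v [] f = 1 := rfl

@[simp] lemma PDCode.weight_cons (v : K) (n : Node) (D : PDCode) (f : ℕ → Fin 3) :
    PDCode.weight v (n :: D) f = n.weight v f * PDCode.weight v D f := by
  simp [PDCode.weight]

@[simp] lemma PDCode.labels_cons (n : Node) (D : PDCode) :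
    PDCode.labels (n :: D) = n.ends ++ PDCode.labels D := rfl

lemma Node.weight_relabel (v : K) (g : ℕ → ℕ) (f : ℕ → Fin 3) (n : Node) :
    (n.relabel g).weight v f = n.weight v (f ∘ g) := by
  cases n <;> rfl

lemma PDCode.weight_relabel (v : K) (g : ℕ → ℕ) (f : ℕ → Fin 3) (D : PDCode) :
    PDCode.weight v (D.map (Node.relabel g)) f = D.weight v (f ∘ g) := by
  simp [PDCode.weight, Function.comp_def, Node.weight_relabel]

lemma PDCode.labels_relabel (g : ℕ → ℕ) (D : PDCode) :
    PDCode.labels (D.map (Node.relabel g)) = D.labels.map g := by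
  induction D with
  | nil => rfl
  | cons n D ih => rw [List.map_cons, PDCode.labels_cons, ih]; cases n <;> rfl

lemma Node.weight_congr (v : K) (n : Node) {f g : ℕ → Fin 3} (h : ∀ i ∈ n.ends, f i = g i) :
    n.weight v f = n.weight v g := by
  cases n <;> simp_all [Node.weight, Node.ends]

lemma PDCode.weight_congr (v : K) (D : PDCode) {f g : ℕ → Fin 3} (h : ∀ i ∈ D.labels, f i = g i) :
    D.weight v f = D.weight v g := by
  induction D with
  | nil => rfl
  | cons n D ih =>
    simp only [PDCode.labels_cons, List.mem_append] at h
    rw [PDCode.weight_cons, PDCode.weight_cons, ih fun i hi => h i (.inr hi),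
      n.weight_congr v fun i hi => h i (.inl hi)]

lemma PDCode.weight_update (v : K) (D : PDCode) (f : ℕ → Fin 3) {a : ℕ} (ha : a ∉ D.labels)
    (x : Fin 3) : D.weight v (Function.update f a x) = D.weight v f :=
  D.weight_congr v fun _ hi => Function.update_of_ne (ne_of_mem_of_not_mem hi ha) _ _

lemma PDCode.weight_dependsOn (v : K) (D : PDCode) : DependsOn (D.weight v) {i | i ∈ D.labels} :=
  fun _ _ h => D.weight_congr v h

lemma partition_nil (v : K) : partition v [] = 1 := by simp [partition, PDCode.labels]

lemma sum_delta_mul (i : Fin 3) (F : Fin 3 → K) : ∑ x, delta i x * F x = F i := by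
  simp [delta]

variable [CharZero K]

lemma partition_eq_avgs (v : K) (D : PDCode) {l : List ℕ} (h : D.labels ⊆ l) (f : ℕ → Fin 3) :
    partition v D = avgs l (D.weight v) f :=
  avgs_congr_of_subset (D.weight_dependsOn v) (List.Subset.refl _) h _ _

/-- A local identity between weights, in which some labels are averaged out, gives an identity
between partition functions. -/
lemma partition_eq_of_avgs {v : K} {D D' : PDCode} (c : K) (k k' : List ℕ)
    (h : ∀ f, avgs k (D.weight v) f = c * avgs k' (D'.weight v) f) :
    partition v D = c * partition v D' := by
  have hl : k ⊆ k ++ k' ++ D.labels ++ D'.labels := fun x hx => by simp [hx]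
  have hl' : k' ⊆ k ++ k' ++ D.labels ++ D'.labels := fun x hx => by simp [hx]
  have hD : D.labels ⊆ k ++ k' ++ D.labels ++ D'.labels := fun x hx => by simp [hx]
  have hD' : D'.labels ⊆ k ++ k' ++ D.labels ++ D'.labels := fun x hx => by simp [hx]
  rw [partition_eq_avgs v D hD 0, partition_eq_avgs v D' hD' 0, ← avgs_avgs_of_subset hl,
    funext h, avgs_mul_const, avgs_avgs_of_subset hl']

lemma partition_perm (v : K) {D D' : PDCode} (h : D.Perm D') : partition v D = partition v D' := by
  simpa using partition_eq_of_avgs (D := D) (D' := D') (v := v) 1 [] [] fun f => by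
    simpa [PDCode.weight] using (h.map _).prod_eq

lemma partition_rename (v : K) (D : PDCode) (g : ℕ → ℕ) (hg : Function.Injective g) :
    partition v (D.map (Node.relabel g)) = partition v D := by
  have : PDCode.weight v (D.map (Node.relabel g)) = fun f => D.weight v (f ∘ g) :=
    funext fun f => D.weight_relabel v g f
  rw [partition, PDCode.labels_relabel, this, avgs_map g hg]
  exact (partition_eq_avgs v D (List.Subset.refl _) _).symm

lemma partition_turnX (v : K) (D : PDCode) (a b c d : ℕ) :
    partition v (.X a b c d :: D) = partition v (.X c d a b :: D) := by
  simpa using partition_eq_of_avgs (v := v) (D := .X a b c d :: D) (D' := .X c d a b :: D) 1 [] []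
    fun f => by simp [Node.weight, crossingWeight, delta_comm, mul_comm]

lemma partition_turnP (v : K) (D : PDCode) (a b : ℕ) :
    partition v (.P a b :: D) = partition v (.P b a :: D) := by
  simpa using partition_eq_of_avgs (v := v) (D := .P a b :: D) (D' := .P b a :: D) 1 [] []
    fun f => by simp [Node.weight, delta_comm]

/-- The skein relation. -/
lemma partition_crossing (v : K) (D : PDCode) (a b c d : ℕ) :
    partition v (.X a b c d :: D) = partition v (.P a b :: .P c d :: D) -
      v * partition v (.P a d :: .P b c :: D) := by
  set l := [a, b, c, d] ++ D.labels
  rw [partition_eq_avgs v _ (l := l) (fun x hx => by simpa [l, Node.ends] using hx) 0,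
    partition_eq_avgs v (.P a b :: .P c d :: D) (l := l)
      (fun x hx => by simpa [l, Node.ends] using hx) 0,
    partition_eq_avgs v (.P a d :: .P b c :: D) (l := l)
      (fun x hx => by simp [l, Node.ends] at hx ⊢; tauto) 0, ← congrFun (avgs_mul_const l v _) 0,
    ← congrFun (avgs_sub l _ _) 0]
  congr 1
  funext f
  simp only [PDCode.weight_cons, Node.weight, crossingWeight]
  ring

/-- A circle without crossings contributes the factor `3`. -/
lemma partition_circle (v : K) (D : PDCode) (a : ℕ) :
    partition v (.P a a :: D) = 3 * partition v D :=
  partition_eq_of_avgs 3 [] [] fun f => by simp [Node.weight]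

lemma partition_unmark (v : K) (D : PDCode) {a b : ℕ} (hab : a ≠ b) :
    partition v (.P a b :: D) =
      partition v (D.map (Node.relabel fun x => if x = b then a else x)) := by
  rw [← one_mul (partition v (D.map _))]
  refine partition_eq_of_avgs 1 [b] [] fun f => ?_
  have h : f ∘ (fun x => if x = b then a else x) = Function.update f b (f a) := by
    funext x
    by_cases hx : x = b <;> simp [hx]
  simp only [avgs_cons, avgs_nil, avg, PDCode.weight_relabel, h, PDCode.weight_cons, Node.weight,
    Function.update_of_ne hab, Function.update_self, mul_assoc, ← Finset.mul_sum]
  rw [sum_delta_mul (f a) (fun x => PDCode.weight v D (Function.update f b x))]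
  field_simp

end PartitionFunction

/-! ### Local identities for the Reidemeister moves -/

section Moves

variable {K : Type*} [Field K]

lemma Node.weight_mirror {v : K} (hv : v ^ 2 = 3 * v - 1) (f : ℕ → Fin 3) (a b c d : ℕ) :
    (Node.mirror (.X a b c d)).weight v f = -v * (Node.X a b c d).weight (3 - v) f := by
  simp only [Node.mirror, Node.weight, crossingWeight, delta_comm (f d) (f a),
    delta_comm (f b) (f a)]
  linear_combination (9 * (delta (f a) (f d) * delta (f b) (f c))) * hv

lemma sum_delta_mul' (i : Fin 3) (F : Fin 3 → K) : ∑ x, delta x i * F x = F i := by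
  simp [delta]

/-- The sum over the colour `x` of an edge that joins two crossings. -/
lemma sum_smoothings (p q r s : Fin 3) (A B C E : K) :
    ∑ x, (A * delta x p - B * delta x q) * (C * delta x r - E * delta x s) =
      A * C * delta p r - A * E * delta p s - B * C * delta q r + B * E * delta q s := by
  have h : ∀ x, (A * delta x p - B * delta x q) * (C * delta x r - E * delta x s) =
      delta x p * (A * C * delta x r - A * E * delta x s) -
        delta x q * (B * C * delta x r - B * E * delta x s) := fun x => by ring
  simp only [h, Finset.sum_sub_distrib, sum_delta_mul']
  ring

lemma sum_sum_delta_mul (a b : Fin 3) (H : Fin 3 → Fin 3 → K) :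
    ∑ p, ∑ q, delta p a * delta q b * H p q = H a b := by
  simp only [mul_assoc, ← Finset.mul_sum, sum_delta_mul' b (fun q => H _ q)]
  exact sum_delta_mul' a (fun p => H p b)

/-- Three crossings that bound a triangle, with the colours `x`, `y` on the outer edges. The
coefficients `s` and `t` of the smoothings of the second crossing are arbitrary. The right-hand side
does not change when `x` and `y` are exchanged. -/
lemma sum_triangle {v : K} (hv : v ^ 2 = 3 * v - 1) (s t : K) (x₀ x₁ x₂ y₀ y₁ y₂ : Fin 3) :
    ∑ p, ∑ q, ∑ r, crossingWeight v p r x₀ y₂ *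
        (9 * (s * (delta y₀ q * delta p x₁) + t * (delta y₀ x₁ * delta q p)) *
          crossingWeight v y₁ r q x₂) =
      729 * (s * (delta x₀ y₂ * delta y₀ x₂ * delta y₁ x₁
          - v * (delta x₀ y₂ * delta y₁ x₂ * delta y₀ x₁)
          - v * (delta x₀ y₁ * delta y₀ x₂ * delta y₂ x₁)
          + v ^ 2 * (delta y₁ x₂ * delta y₀ x₀ * delta y₂ x₁))
        - v * t * (delta x₀ y₁ * delta y₀ x₁ * delta y₂ x₂)) := by
  set M : Fin 3 → Fin 3 → K := fun p q => s * (delta y₀ q * delta p x₁) +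
    t * (delta y₀ x₁ * delta q p) with hM
  have inner (p q : Fin 3) : ∑ r, crossingWeight v p r x₀ y₂ *
      (9 * (s * (delta y₀ q * delta p x₁) + t * (delta y₀ x₁ * delta q p)) *
        crossingWeight v y₁ r q x₂) =
      729 * (delta x₀ y₂ * (delta p y₁ * delta q x₂ * M p q)
        - v * (delta x₀ y₂ * delta y₁ x₂) * (delta p q * M p q)
        - v * delta x₀ y₁ * (delta p y₂ * delta q x₂ * M p q)
        + v ^ 2 * delta y₁ x₂ * (delta p y₂ * delta q x₀ * M p q)) := by
    have := sum_smoothings p x₀ y₁ q (delta x₀ y₂) (v * delta p y₂) (delta q x₂)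
      (v * delta y₁ x₂)
    calc _ = 729 * M p q * ∑ r, (delta x₀ y₂ * delta r p -
          v * delta p y₂ * delta r x₀) * (delta q x₂ * delta r y₁ -
          v * delta y₁ x₂ * delta r q) := by
          rw [Finset.mul_sum]
          refine Finset.sum_congr rfl fun r _ => ?_
          simp only [crossingWeight, delta_comm p r, delta_comm y₁ r, hM]
          ring
      _ = _ := by
          rw [this, delta_comm x₀ q]
          ring
  have diag : ∑ p, ∑ q, delta p q * M p q = (s + 3 * t) * delta y₀ x₁ := by
    have contract (p : Fin 3) : ∑ q, delta p q * M p q = M p p := sum_delta_mul p (M p)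
    simp only [contract]
    simp only [hM, Finset.sum_add_distrib, delta_self, ← Finset.mul_sum,
      sum_delta_mul y₀ (fun p => delta p x₁)]
    simp only [Finset.sum_const, Finset.card_univ, Fintype.card_fin, nsmul_eq_mul]
    push_cast
    ring
  simp only [inner, ← Finset.mul_sum, Finset.sum_add_distrib, Finset.sum_sub_distrib, diag,
    sum_sum_delta_mul _ _ M]
  simp only [hM]
  rw [delta_comm x₂ y₁, delta_comm x₂ y₂]
  linear_combination 729 * t * (delta x₀ y₂ * delta y₁ x₂ * delta y₀ x₁) * hv

lemma crossingWeight_turn (v : K) (i j k l : Fin 3) :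
    crossingWeight v i j k l = crossingWeight v k l i j := by
  simp only [crossingWeight, delta_comm l i, delta_comm k j]
  ring

/-- The third Reidemeister move for the weights. -/
lemma sum_triangle_swap {v : K} (hv : v ^ 2 = 3 * v - 1) (x₀ x₁ x₂ y₀ y₁ y₂ : Fin 3) :
    ∑ p, ∑ q, ∑ r, crossingWeight v p r x₀ y₂ *
        (crossingWeight v y₀ q p x₁ * crossingWeight v y₁ r q x₂) =
      ∑ p, ∑ q, ∑ r, crossingWeight v y₀ x₂ p r *
        (crossingWeight v p y₁ x₀ q * crossingWeight v q y₂ x₁ r) := by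
  simp only [crossingWeight_turn v y₀ x₂, crossingWeight_turn v _ y₁, crossingWeight_turn v _ y₂]
  have h (i j k l : Fin 3) : crossingWeight v i j k l =
      9 * (1 * (delta i j * delta k l) + -v * (delta i l * delta j k)) := by
    rw [crossingWeight]; ring
  simp only [h y₀ _ _ x₁, h x₀ _ _ y₁, sum_triangle hv]
  simp only [delta_comm x₀, delta_comm x₁, delta_comm x₂]
  ring

lemma sum_triangle_swap_switched {v : K} (hv : v ^ 2 = 3 * v - 1) (x₀ x₁ x₂ y₀ y₁ y₂ : Fin 3) :
    ∑ p, ∑ q, ∑ r, crossingWeight v p r x₀ y₂ *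
        (crossingWeight v q p x₁ y₀ * crossingWeight v y₁ r q x₂) =
      ∑ p, ∑ q, ∑ r, crossingWeight v y₀ x₂ p r *
        (crossingWeight v y₁ x₀ q p * crossingWeight v q y₂ x₁ r) := by
  simp only [crossingWeight_turn v y₀ x₂, crossingWeight_turn v y₁ x₀, crossingWeight_turn v _ y₂]
  have h (i j k l : Fin 3) : crossingWeight v i j k l =
      9 * (-v * (delta l i * delta j k) + 1 * (delta l k * delta i j)) := by
    rw [crossingWeight, delta_comm l i, delta_comm l k]; ring
  simp only [h _ _ x₁ y₀, h _ _ y₁ x₀, sum_triangle hv]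
  simp only [delta_comm x₀, delta_comm x₁, delta_comm x₂]
  ring

/-- Averages over the inner edges of a triangle. -/
lemma avgs_three {u₀ u₁ u₂ : ℕ} (h₀₁ : u₀ ≠ u₁) (h₀₂ : u₀ ≠ u₂) (h₁₂ : u₁ ≠ u₂)
    (G : (ℕ → Fin 3) → K) (T : Fin 3 → Fin 3 → Fin 3 → K) (f : ℕ → Fin 3)
    (h : ∀ g : ℕ → Fin 3, (∀ i, i ≠ u₀ → i ≠ u₁ → i ≠ u₂ → g i = f i) →
      G g = T (g u₀) (g u₁) (g u₂)) :
    avgs [u₀, u₁, u₂] G f = (∑ p, ∑ q, ∑ r, T p q r) / 27 := by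
  simp only [avgs_cons, avgs_nil, avg, ← Finset.sum_div, div_div]
  congr 1
  · refine Finset.sum_congr rfl fun p _ => Finset.sum_congr rfl fun q _ =>
      Finset.sum_congr rfl fun r _ => ?_
    rw [h _ fun i h0 h1 h2 => by simp [h0, h1, h2]]
    simp [h₀₁, h₀₂, h₁₂]
  · norm_num

variable [CharZero K]

/-- The first Reidemeister move, for a curl whose loop closes up under the `1`-smoothing. -/
lemma partition_r1 {v : K} {D : PDCode} {a b c : ℕ} (hb : b ≠ a) (hc : c ≠ a)
    (hD : a ∉ D.labels) :
    partition v (.X a a b c :: D) = (3 - v) * partition v (.P b c :: D) := by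
  refine partition_eq_of_avgs _ [a] [] fun f => ?_
  simp only [avgs_cons, avgs_nil, avg, PDCode.weight_cons, Node.weight, crossingWeight,
    D.weight_update v f hD, Function.update_self, Function.update_of_ne hb,
    Function.update_of_ne hc, delta_self]
  simp only [← Finset.sum_mul, ← Finset.mul_sum, Finset.sum_sub_distrib, sum_delta_mul']
  simp only [Finset.sum_const, Finset.card_univ, Fintype.card_fin, nsmul_eq_mul,
    delta_comm (f c) (f b)]
  push_cast
  ring

/-- The first Reidemeister move, for a curl whose loop closes up under the `-v`-smoothing. -/
lemma partition_r1_switched {v : K} {D : PDCode} {a b c : ℕ} (hb : b ≠ a) (hc : c ≠ a)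
    (hD : a ∉ D.labels) :
    partition v (.X b a a c :: D) = (1 - 3 * v) * partition v (.P b c :: D) := by
  refine partition_eq_of_avgs _ [a] [] fun f => ?_
  simp only [avgs_cons, avgs_nil, avg, PDCode.weight_cons, Node.weight, crossingWeight,
    D.weight_update v f hD, Function.update_self, Function.update_of_ne hb,
    Function.update_of_ne hc, delta_self]
  simp only [← Finset.sum_mul, ← Finset.mul_sum, Finset.sum_sub_distrib,
    sum_delta_mul (f b) (fun x => delta x (f c))]
  simp only [Finset.sum_const, Finset.card_univ, Fintype.card_fin, nsmul_eq_mul]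
  push_cast
  ring

/-- The second Reidemeister move. -/
lemma partition_r2 {v : K} (hv : v ^ 2 = 3 * v - 1) {D : PDCode} {a b e f g h : ℕ} (hab : a ≠ b)
    (ha : a ∉ [e, f, g, h] ++ D.labels) (hb : b ∉ [e, f, g, h] ++ D.labels) :
    partition v (.X a b e f :: .X a g h b :: D) = -v * partition v (.P e h :: .P f g :: D) := by
  simp only [List.cons_append, List.nil_append, List.mem_cons, not_or, ← ne_eq] at ha hb
  obtain ⟨hae, haf, hag, hah, haD⟩ := ha
  obtain ⟨hbe, hbf, hbg, hbh, hbD⟩ := hb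
  refine partition_eq_of_avgs _ [b, a] [] fun F => ?_
  simp only [avgs_cons, avgs_nil, avg, PDCode.weight_cons, Node.weight, crossingWeight,
    D.weight_update v _ haD, D.weight_update v _ hbD, Function.update_self,
    Function.update_of_ne hab.symm, Function.update_of_ne hae.symm, Function.update_of_ne haf.symm,
    Function.update_of_ne hag.symm, Function.update_of_ne hah.symm, Function.update_of_ne hbe.symm,
    Function.update_of_ne hbf.symm, Function.update_of_ne hbg.symm, Function.update_of_ne hbh.symm]
  have key (y : Fin 3) : ∑ x, (9 * (delta x y * delta (F e) (F f) -
      v * (delta x (F f) * delta y (F e)))) * (9 * (delta x (F g) * delta (F h) y -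
      v * (delta x y * delta (F g) (F h))) * D.weight v F) =
      81 * D.weight v F * (delta y (F g) * (delta (F e) (F f) * delta (F h) y)
        - v * delta (F e) (F f) * delta (F g) (F h)
        - delta y (F e) * (v * delta (F f) (F g) * delta (F h) y)
        + delta y (F e) * (v ^ 2 * delta (F g) (F h) * delta (F f) y)) := by
    have := sum_smoothings y (F f) (F g) y (delta (F e) (F f)) (v * delta y (F e))
      (delta (F h) y) (v * delta (F g) (F h))
    rw [delta_self] at this
    calc _ = 81 * D.weight v F * ∑ x, (delta (F e) (F f) * delta x y -
          v * delta y (F e) * delta x (F f)) *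
          (delta (F h) y * delta x (F g) - v * delta (F g) (F h) * delta x y) := by
          rw [Finset.mul_sum]
          exact Finset.sum_congr rfl fun x _ => by ring
      _ = _ := by rw [this]; ring
  simp only [key, ← Finset.sum_div, ← Finset.mul_sum, Finset.sum_add_distrib,
    Finset.sum_sub_distrib, sum_delta_mul']
  simp only [Finset.sum_const, Finset.card_univ, Fintype.card_fin, nsmul_eq_mul,
    delta_comm (F f) (F e), delta_comm (F h) (F e), delta_comm (F h) (F g)]
  push_cast
  linear_combination 9 * D.weight v F * (delta (F e) (F f) * delta (F g) (F h)) * hv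

/-- The third Reidemeister moves, in the form of an identity between the weights of the three
crossings, averaged over the inner edges. -/
lemma partition_triangle {v : K} {D : PDCode} {u₀ u₁ u₂ : ℕ} (h₀₁ : u₀ ≠ u₁) (h₀₂ : u₀ ≠ u₂)
    (h₁₂ : u₁ ≠ u₂) (h₀ : u₀ ∉ D.labels) (h₁ : u₁ ∉ D.labels) (h₂ : u₂ ∉ D.labels)
    (m₁ m₂ m₃ n₁ n₂ n₃ : Node) (S T : (ℕ → Fin 3) → Fin 3 → Fin 3 → Fin 3 → K)
    (hS : ∀ f g, (∀ i, i ≠ u₀ → i ≠ u₁ → i ≠ u₂ → g i = f i) →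
      m₁.weight v g * (m₂.weight v g * m₃.weight v g) = S f (g u₀) (g u₁) (g u₂))
    (hT : ∀ f g, (∀ i, i ≠ u₀ → i ≠ u₁ → i ≠ u₂ → g i = f i) →
      n₁.weight v g * (n₂.weight v g * n₃.weight v g) = T f (g u₀) (g u₁) (g u₂))
    (h : ∀ f, ∑ p, ∑ q, ∑ r, S f p q r = ∑ p, ∑ q, ∑ r, T f p q r) :
    partition v (m₁ :: m₂ :: m₃ :: D) = partition v (n₁ :: n₂ :: n₃ :: D) := by
  rw [← one_mul (partition v (n₁ :: _))]
  refine partition_eq_of_avgs 1 [u₀, u₁, u₂] [u₀, u₁, u₂] fun f => ?_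
  have hD (g : ℕ → Fin 3) (hg : ∀ i, i ≠ u₀ → i ≠ u₁ → i ≠ u₂ → g i = f i) :
      D.weight v g = D.weight v f := D.weight_congr v fun i hi =>
    hg i (ne_of_mem_of_not_mem hi h₀) (ne_of_mem_of_not_mem hi h₁) (ne_of_mem_of_not_mem hi h₂)
  rw [avgs_three h₀₁ h₀₂ h₁₂ _ (fun p q r => S f p q r * D.weight v f) f fun g hg => by
      rw [← hS f g hg, ← hD g hg]; simp only [PDCode.weight_cons]; ring,
    avgs_three h₀₁ h₀₂ h₁₂ _ (fun p q r => T f p q r * D.weight v f) f fun g hg => by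
      rw [← hT f g hg, ← hD g hg]; simp only [PDCode.weight_cons]; ring, one_mul]
  simp only [← Finset.sum_mul, h]

end Moves

/-! ### Invariance under elementary moves -/

section Invariance

lemma triangle_labels {u₀ u₁ u₂ : ℕ} {L : List ℕ}
    (h : ∀ a, (u₀ :: u₀ :: u₁ :: u₁ :: u₂ :: u₂ :: L).count a ≤ 2) :
    (u₀ ≠ u₁ ∧ u₀ ≠ u₂ ∧ u₁ ≠ u₂) ∧ u₀ ∉ L ∧ u₁ ∉ L ∧ u₂ ∉ L := by
  have h0 := h u₀
  have h1 := h u₁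
  have h2 := h u₂
  have h01 : u₀ ≠ u₁ := by rintro rfl; simp at h0
  have h02 : u₀ ≠ u₂ := by rintro rfl; simp [h01.symm] at h0
  have h12 : u₁ ≠ u₂ := by rintro rfl; simp [h01] at h1
  simp [h01, h02, h12, h01.symm, h02.symm, h12.symm, List.count_eq_zero] at h0 h1 h2
  exact ⟨⟨h01, h02, h12⟩, h0, h1, h2⟩

variable {K : Type*} [Field K] [CharZero K]

/-- An elementary move multiplies the partition function at a root `v` by a unit `±v ^ k`; at the
other root `w = 1 / v` the factor is the inverse unit, so the product of both values is
unchanged. -/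
lemma Move.partition_eq {v w : K} (hv : v ^ 2 = 3 * v - 1) (hw : w = 3 - v) {D D' : PDCode}
    (hD : ∀ a, D.labels.count a ≤ 2) (h : Move D D') :
    partition v D * partition w D = partition v D' * partition w D' := by
  have hw2 : w ^ 2 = 3 * w - 1 := by rw [hw]; linear_combination hv
  have hvw : v * w = 1 := by rw [hw]; linear_combination -hv
  cases h with
  | reorder h => rw [partition_perm v h, partition_perm w h]
  | rename _ f hf => rw [partition_rename v D f hf, partition_rename w D f hf]
  | turnX D a b c d => rw [partition_turnX v, partition_turnX w]
  | turnP D a b => rw [partition_turnP v, partition_turnP w]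
  | unmark D a b hab => rw [partition_unmark v _ hab, partition_unmark w _ hab]
  | r1 D a b c =>
    have ha := hD a
    simp only [PDCode.labels_cons, Node.ends, List.cons_append, List.nil_append,
      List.count_cons] at ha
    have hb : b ≠ a := by rintro rfl; simp at ha
    have hc : c ≠ a := by rintro rfl; simp at ha
    have ha : a ∉ PDCode.labels D := List.count_eq_zero.1 (by simp at ha; omega)
    rw [partition_r1 hb hc ha, partition_r1 hb hc ha, hw]
    linear_combination (-partition v (.P b c :: D) * partition (3 - v) (.P b c :: D)) * hv
  | r1_switched D a b c =>
    have ha := hD a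
    simp only [PDCode.labels_cons, Node.ends, List.cons_append, List.nil_append,
      List.count_cons] at ha
    have hb : b ≠ a := by rintro rfl; simp at ha
    have hc : c ≠ a := by rintro rfl; simp at ha; omega
    have ha : a ∉ PDCode.labels D := List.count_eq_zero.1 (by simp at ha; omega)
    rw [partition_r1_switched hb hc ha, partition_r1_switched hb hc ha, hw]
    linear_combination (-9 * partition v (.P b c :: D) * partition (3 - v) (.P b c :: D)) * hv
  | r2 D a b e f g h =>
    have ha := hD a
    have hb := hD b
    simp only [PDCode.labels_cons, Node.ends, List.cons_append, List.nil_append,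
      List.count_cons, beq_iff_eq] at ha hb
    have hab : a ≠ b := by rintro rfl; simp at ha
    simp only [hab, hab.symm, if_true, if_false] at ha hb
    have ha : List.count a ([e, f, g, h] ++ PDCode.labels D) = 0 := by
      simp only [List.cons_append, List.nil_append, List.count_cons, beq_iff_eq]; omega
    have hb : List.count b ([e, f, g, h] ++ PDCode.labels D) = 0 := by
      simp only [List.cons_append, List.nil_append, List.count_cons, beq_iff_eq]; omega
    rw [partition_r2 hv hab (List.count_eq_zero.1 ha) (List.count_eq_zero.1 hb),
      partition_r2 hw2 hab (List.count_eq_zero.1 ha) (List.count_eq_zero.1 hb)]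
    linear_combination (partition v (.P e h :: .P f g :: D) *
      partition w (.P e h :: .P f g :: D)) * hvw
  | r3 D u₀ u₁ u₂ x₀ x₁ x₂ y₀ y₁ y₂ =>
    obtain ⟨⟨h01, h02, h12⟩, h0, h1, h2⟩ := triangle_labels (u₀ := u₀) (u₁ := u₁) (u₂ := u₂)
      (L := [x₀, x₁, x₂, y₀, y₁, y₂] ++ D.labels) fun a => by
        have := hD a
        simp only [PDCode.labels_cons, Node.ends, List.cons_append, List.nil_append,
          List.count_cons] at this ⊢
        linarith
    simp only [List.cons_append, List.nil_append, List.mem_cons, not_or, ← ne_eq] at h0 h1 h2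
    obtain ⟨a₀, a₁, a₂, a₃, a₄, a₅, h0⟩ := h0
    obtain ⟨b₀, b₁, b₂, b₃, b₄, b₅, h1⟩ := h1
    obtain ⟨c₀, c₁, c₂, c₃, c₄, c₅, h2⟩ := h2
    have key {z : K} (hz : z ^ 2 = 3 * z - 1) :
        partition z (.X u₀ u₂ x₀ y₂ :: .X y₀ u₁ u₀ x₁ :: .X y₁ u₂ u₁ x₂ :: D) =
          partition z (.X y₀ x₂ u₀ u₂ :: .X u₀ y₁ x₀ u₁ :: .X u₁ y₂ x₁ u₂ :: D) := by
      refine partition_triangle h01 h02 h12 h0 h1 h2 _ _ _ _ _ _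
        (fun f p q r => crossingWeight z p r (f x₀) (f y₂) *
          (crossingWeight z (f y₀) q p (f x₁) * crossingWeight z (f y₁) r q (f x₂)))
        (fun f p q r => crossingWeight z (f y₀) (f x₂) p r *
          (crossingWeight z p (f y₁) (f x₀) q * crossingWeight z q (f y₂) (f x₁) r))
        (fun f g hg => ?_) (fun f g hg => ?_) (fun f => sum_triangle_swap hz _ _ _ _ _ _)
      all_goals
        have hx₀ : g x₀ = f x₀ := hg _ a₀.symm b₀.symm c₀.symm
        have hx₁ : g x₁ = f x₁ := hg _ a₁.symm b₁.symm c₁.symm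
        have hx₂ : g x₂ = f x₂ := hg _ a₂.symm b₂.symm c₂.symm
        have hy₀ : g y₀ = f y₀ := hg _ a₃.symm b₃.symm c₃.symm
        have hy₁ : g y₁ = f y₁ := hg _ a₄.symm b₄.symm c₄.symm
        have hy₂ : g y₂ = f y₂ := hg _ a₅.symm b₅.symm c₅.symm
        simp only [Node.weight, hx₀, hx₁, hx₂, hy₀, hy₁, hy₂]
    rw [key hv, key hw2]
  | r3_switched D u₀ u₁ u₂ x₀ x₁ x₂ y₀ y₁ y₂ =>
    obtain ⟨⟨h01, h02, h12⟩, h0, h1, h2⟩ := triangle_labels (u₀ := u₀) (u₁ := u₁) (u₂ := u₂)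
      (L := [x₀, x₁, x₂, y₀, y₁, y₂] ++ D.labels) fun a => by
        have := hD a
        simp only [PDCode.labels_cons, Node.ends, List.cons_append, List.nil_append,
          List.count_cons] at this ⊢
        linarith
    simp only [List.cons_append, List.nil_append, List.mem_cons, not_or, ← ne_eq] at h0 h1 h2
    obtain ⟨a₀, a₁, a₂, a₃, a₄, a₅, h0⟩ := h0
    obtain ⟨b₀, b₁, b₂, b₃, b₄, b₅, h1⟩ := h1
    obtain ⟨c₀, c₁, c₂, c₃, c₄, c₅, h2⟩ := h2
    have key {z : K} (hz : z ^ 2 = 3 * z - 1) :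
        partition z (.X u₀ u₂ x₀ y₂ :: .X u₁ u₀ x₁ y₀ :: .X y₁ u₂ u₁ x₂ :: D) =
          partition z (.X y₀ x₂ u₀ u₂ :: .X y₁ x₀ u₁ u₀ :: .X u₁ y₂ x₁ u₂ :: D) := by
      refine partition_triangle h01 h02 h12 h0 h1 h2 _ _ _ _ _ _
        (fun f p q r => crossingWeight z p r (f x₀) (f y₂) *
          (crossingWeight z q p (f x₁) (f y₀) * crossingWeight z (f y₁) r q (f x₂)))
        (fun f p q r => crossingWeight z (f y₀) (f x₂) p r *
          (crossingWeight z (f y₁) (f x₀) q p * crossingWeight z q (f y₂) (f x₁) r))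
        (fun f g hg => ?_) (fun f g hg => ?_) (fun f => sum_triangle_swap_switched hz _ _ _ _ _ _)
      all_goals
        have hx₀ : g x₀ = f x₀ := hg _ a₀.symm b₀.symm c₀.symm
        have hx₁ : g x₁ = f x₁ := hg _ a₁.symm b₁.symm c₁.symm
        have hx₂ : g x₂ = f x₂ := hg _ a₂.symm b₂.symm c₂.symm
        have hy₀ : g y₀ = f y₀ := hg _ a₃.symm b₃.symm c₃.symm
        have hy₁ : g y₁ = f y₁ := hg _ a₄.symm b₄.symm c₄.symm
        have hy₂ : g y₂ = f y₂ := hg _ a₅.symm b₅.symm c₅.symm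
        simp only [Node.weight, hx₀, hx₁, hx₂, hy₀, hy₁, hy₂]
    rw [key hv, key hw2]

end Invariance

/-! ### Numbering the ends of the pieces -/

/-- The number of an end, when the ends of all pieces are counted one after the other. -/
def PDCode.code : (D : PDCode) → D.Dart → ℕ
  | [], x => x.1.elim0
  | _ :: _, ⟨⟨0, _⟩, j⟩ => j.1
  | n :: D, ⟨⟨i + 1, h⟩, j⟩ =>
    n.ends.length + PDCode.code D ⟨⟨i, Nat.lt_of_succ_lt_succ h⟩, j⟩

/-- An end of the first piece of a diagram. -/
def PDCode.headDart (n : Node) (D : PDCode) (j : Fin n.ends.length) : PDCode.Dart (n :: D) :=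
  ⟨⟨0, Nat.succ_pos _⟩, j⟩

/-- An end of one of the other pieces. -/
def PDCode.tailDart (n : Node) (D : PDCode) (x : D.Dart) : PDCode.Dart (n :: D) :=
  ⟨x.1.succ, x.2⟩

@[elab_as_elim]
lemma PDCode.dart_cases {n : Node} {D : PDCode} {p : PDCode.Dart (n :: D) → Prop}
    (head : ∀ j, p (headDart n D j)) (tail : ∀ x, p (tailDart n D x)) (x : PDCode.Dart (n :: D)) :
    p x := by
  obtain ⟨⟨i, hi⟩, j⟩ := x
  cases i with
  | zero => exact head j
  | succ i => exact tail ⟨⟨i, Nat.lt_of_succ_lt_succ hi⟩, j⟩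

@[simp] lemma PDCode.code_headDart (n : Node) (D : PDCode) (j : Fin n.ends.length) :
    PDCode.code (n :: D) (headDart n D j) = j := rfl

@[simp] lemma PDCode.code_tailDart (n : Node) (D : PDCode) (x : D.Dart) :
    PDCode.code (n :: D) (tailDart n D x) = n.ends.length + D.code x := rfl

lemma PDCode.code_lt (D : PDCode) (x : D.Dart) : D.code x < D.labels.length := by
  induction D with
  | nil => exact x.1.elim0
  | cons n D ih =>
    rw [PDCode.labels_cons, List.length_append]
    cases x using PDCode.dart_cases with
    | head j => simpa using j.2.trans_le (Nat.le_add_right _ _)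
    | tail x => simpa using ih x

lemma PDCode.labels_code (D : PDCode) (x : D.Dart) : D.labels[D.code x]? = some (D.label x) := by
  induction D with
  | nil => exact x.1.elim0
  | cons n D ih =>
    rw [PDCode.labels_cons]
    cases x using PDCode.dart_cases with
    | head j =>
      rw [PDCode.code_headDart, List.getElem?_append_left j.2, List.getElem?_eq_getElem j.2]
      rfl
    | tail x =>
      rw [PDCode.code_tailDart, List.getElem?_append_right (by simp), Nat.add_sub_cancel_left, ih]
      rfl

lemma PDCode.code_injective (D : PDCode) : Function.Injective D.code := by
  induction D with
  | nil => exact fun x => x.1.elim0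
  | cons n D ih =>
    intro x y
    cases x using PDCode.dart_cases with | head j => ?_ | tail x => ?_ <;>
      cases y using PDCode.dart_cases with | head j' => ?_ | tail y => ?_ <;>
      simp only [PDCode.code_headDart, PDCode.code_tailDart]
    · exact fun h => by rw [Fin.ext h]
    · exact fun h => by have := j.2; omega
    · exact fun h => by have := j'.2; omega
    · exact fun h => by rw [ih (Nat.add_left_cancel h)]

lemma PDCode.exists_code_eq (D : PDCode) {c : ℕ} (hc : c < D.labels.length) :
    ∃ x, D.code x = c := by
  induction D generalizing c with
  | nil => simp [PDCode.labels] at hc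
  | cons n D ih =>
    rw [PDCode.labels_cons, List.length_append] at hc
    by_cases h : c < n.ends.length
    · exact ⟨headDart n D ⟨c, h⟩, rfl⟩
    · obtain ⟨x, hx⟩ := ih (c := c - n.ends.length) (by omega)
      exact ⟨tailDart n D x, by rw [PDCode.code_tailDart, hx]; omega⟩

/-- The ends of the pieces are numbered bijectively. -/
noncomputable def PDCode.dartEquiv (D : PDCode) : D.Dart ≃ Fin D.labels.length :=
  Equiv.ofBijective (fun x => ⟨D.code x, D.code_lt x⟩)
    ⟨fun _ _ h => D.code_injective (Fin.val_eq_of_eq h), fun c =>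
      (D.exists_code_eq c.2).imp fun _ h => Fin.ext h⟩

lemma PDCode.card_dart (D : PDCode) : Nat.card D.Dart = D.labels.length := by
  rw [Nat.card_congr D.dartEquiv, Nat.card_fin]

/-- In a knot diagram no label occurs more than twice. -/
lemma PDCode.IsKnotDiagram.count_le_two {D : PDCode} (h : D.IsKnotDiagram) (a : ℕ) :
    D.labels.count a ≤ 2 := by
  by_contra! hc
  rw [← Nat.succ_le_iff, List.replicate_sublist_iff.symm,
    List.sublist_iff_exists_fin_orderEmbedding_get_eq] at hc
  obtain ⟨f, hf⟩ := hc
  have hdart (i : Fin 3) : ∃ x : D.Dart, D.code x = f ⟨i, by simp⟩ ∧ D.label x = a := by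
    obtain ⟨x, hx⟩ := D.exists_code_eq (f ⟨i, by simp⟩).2
    refine ⟨x, hx, ?_⟩
    have := D.labels_code x
    have hfi := hf ⟨i, by simp⟩
    simp only [List.get_eq_getElem, List.getElem_replicate] at hfi
    rw [hx, List.getElem?_eq_getElem (f ⟨i, by simp⟩).2, ← hfi] at this
    exact (Option.some_injective _ this).symm
  choose x hx hl using hdart
  have hne {i j : Fin 3} (hij : i ≠ j) : x i ≠ x j := fun h => by
    have := hx i
    rw [h, hx j, Fin.val_inj, f.injective.eq_iff, Fin.mk.injEq] at this
    exact hij (Fin.ext this.symm)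
  exact hne (show (1 : Fin 3) ≠ 2 by decide) ((h.edges (x 0)).unique
    ⟨hne (by decide), (hl 0).trans (hl 1).symm⟩ ⟨hne (by decide), (hl 0).trans (hl 2).symm⟩)

/-! ### The invariant -/

section Mirror

variable {K : Type*} [Field K]

lemma PDCode.weight_mirror (D : PDCode) : ∃ k : ℕ, ∀ v : K, v ^ 2 = 3 * v - 1 → ∀ f,
    D.mirror.weight v f = (-v) ^ k * D.weight (3 - v) f := by
  induction D with
  | nil => exact ⟨0, fun v _ f => by simp [PDCode.mirror]⟩
  | cons n D ih =>
    obtain ⟨k, hk⟩ := ih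
    have hn : PDCode.mirror (n :: D) = n.mirror :: PDCode.mirror D := rfl
    cases n with
    | X a b c d =>
      refine ⟨k + 1, fun v hv f => ?_⟩
      rw [hn, PDCode.weight_cons, PDCode.weight_cons, hk v hv, Node.weight_mirror hv]
      ring
    | P a b =>
      refine ⟨k, fun v hv f => ?_⟩
      rw [hn, PDCode.weight_cons, PDCode.weight_cons, hk v hv]
      simp only [Node.mirror, Node.weight]
      ring

variable [CharZero K]

/-- Taking the mirror image exchanges the two roots `v` and `3 - v`, up to a power of `-v`. -/
lemma partition_mirror {v : K} (hv : v ^ 2 = 3 * v - 1) (D : PDCode) :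
    partition v D.mirror * partition (3 - v) D.mirror =
      partition v D * partition (3 - v) D := by
  have hv' : (3 - v) ^ 2 = 3 * (3 - v) - 1 := by linear_combination hv
  obtain ⟨k, hk⟩ := D.weight_mirror (K := K)
  have h {v : K} (hv : v ^ 2 = 3 * v - 1) :
      partition v D.mirror = (-v) ^ k * partition (3 - v) D := by
    set l := D.labels ++ D.mirror.labels
    rw [partition_eq_avgs v _ (l := l) (fun x hx => by simp [l, hx]) 0,
      partition_eq_avgs (3 - v) D (l := l) (fun x hx => by simp [l, hx]) 0, funext (hk v hv),
      avgs_mul_const]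
  have hone : (-v) ^ k * (-(3 - v)) ^ k = 1 := by
    rw [← mul_pow, show -v * -(3 - v) = 1 by linear_combination -hv, one_pow]
  rw [h hv, h hv', sub_sub_cancel]
  linear_combination partition v D * partition (3 - v) D * hone

end Mirror

/-- The root `u = (3 + √5) / 2` of `u ^ 2 = 3 * u - 1`; the other root is `3 - u = 1 / u`. -/
noncomputable def root : ℝ := (3 + √5) / 2

lemma root_sq : root ^ 2 = 3 * root - 1 := by
  have : √5 ^ 2 = 5 := Real.sq_sqrt (by norm_num)
  rw [root]
  linear_combination this / 4

/-- The knot invariant: the norm, from `ℤ[u]` to `ℤ`, of the partition function. Reidemeister moves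
multiply the partition function by `±u ^ k`, and taking the mirror image conjugates it, up to such
a factor; the norm does not change. -/
noncomputable def invariant (D : PDCode) : ℝ := partition root D * partition (3 - root) D

lemma invariant_mirror (D : PDCode) : invariant D.mirror = invariant D :=
  partition_mirror root_sq D

lemma SameKnot.invariant_eq {D D' : PDCode} (h : SameKnot D D') : invariant D = invariant D' := by
  induction h with
  | rel D D' h =>
    exact h.2.2.partition_eq root_sq rfl h.1.count_le_two
  | refl => rfl
  | symm _ _ _ ih => exact ih.symm
  | trans _ _ _ _ _ ih ih' => exact ih.trans ih'

/-! ### Computing the invariant -/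

lemma beq_eq_false_of_ne {a b : ℕ} (h : a ≠ b) : Nat.beq a b = false := by
  rw [← Bool.not_eq_true, Nat.beq_eq]
  exact h

/-- Change the label `b` to `a`. -/
def Node.subst (b a : ℕ) : Node → Node := Node.relabel fun x => bif Nat.beq x b then a else x

lemma Node.subst_eq (b a : ℕ) :
    Node.subst b a = Node.relabel fun x => if x = b then a else x := by
  unfold Node.subst
  congr 1
  funext x
  by_cases h : x = b
  · simp [h]
  · simp [h, beq_eq_false_of_ne h]

/-- The partition function of a diagram by the skein relation. The pair `(a, b)` stands for
`a + b * u`; the first argument bounds the number of steps. -/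
def bracket : ℕ → PDCode → ℤ × ℤ
  | 0, _ => (1, 0)
  | _ + 1, [] => (1, 0)
  | n + 1, .P a b :: D =>
    bif Nat.beq a b then
      let x := bracket n D
      (3 * x.1, 3 * x.2)
    else bracket n (D.map (Node.subst b a))
  | n + 1, .X a b c d :: D =>
    let x := bracket n (.P a b :: .P c d :: D)
    let y := bracket n (.P a d :: .P b c :: D)
    (x.1 + y.2, x.2 - y.1 - 3 * y.2)

/-- The number of steps needed to expand a piece by the skein relation. -/
def Node.cost : Node → ℕ
  | .X _ _ _ _ => 3
  | .P _ _ => 1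

/-- The number of steps needed to expand a diagram by the skein relation. -/
def PDCode.cost (D : PDCode) : ℕ := (D.map Node.cost).sum

@[simp] lemma PDCode.cost_cons (n : Node) (D : PDCode) :
    PDCode.cost (n :: D) = n.cost + PDCode.cost D := by
  simp [PDCode.cost]

lemma PDCode.cost_relabel (g : ℕ → ℕ) (D : PDCode) :
    PDCode.cost (D.map (Node.relabel g)) = D.cost := by
  induction D with
  | nil => rfl
  | cons n D ih => cases n <;> simp_all [Node.relabel, Node.cost]

lemma PDCode.cost_le (D : PDCode) : D.cost ≤ 3 * D.length := by
  induction D with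
  | nil => simp [PDCode.cost]
  | cons n D ih =>
    rw [PDCode.cost_cons, List.length_cons]
    cases n <;> simp only [Node.cost] <;> omega

lemma partition_eq_bracket {K : Type*} [Field K] [CharZero K] {v : K} (hv : v ^ 2 = 3 * v - 1)
    (n : ℕ) (D : PDCode) (h : D.cost ≤ n) :
    partition v D = (bracket n D).1 + (bracket n D).2 * v := by
  induction n generalizing D with
  | zero =>
    cases D with
    | nil => simp [partition_nil, bracket]
    | cons n D => cases n <;> simp [Node.cost] at h
  | succ n ih =>
    rcases D with _ | ⟨⟨a, b, c, d⟩ | ⟨a, b⟩, D⟩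
    · simp [partition_nil, bracket]
    · simp only [PDCode.cost_cons, Node.cost] at h
      rw [partition_crossing, ih _ (by simp only [PDCode.cost_cons, Node.cost]; omega),
        ih _ (by simp only [PDCode.cost_cons, Node.cost]; omega)]
      simp only [bracket]
      push_cast
      linear_combination (-((bracket n (.P a d :: .P b c :: D)).2 : K)) * hv
    · simp only [PDCode.cost_cons, Node.cost] at h
      by_cases hab : a = b
      · subst hab
        rw [partition_circle, ih D (by omega)]
        simp only [bracket, Nat.beq_refl, cond_true]
        push_cast
        ring
      · rw [partition_unmark v D hab, ← Node.subst_eq, ih _ (by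
          rw [Node.subst_eq, PDCode.cost_relabel]; omega)]
        simp [bracket, beq_eq_false_of_ne hab]

/-- The invariant of a diagram, computed by the skein relation. -/
def bracketNorm (D : PDCode) : ℤ :=
  let x := bracket (3 * D.length) D
  x.1 * x.1 + 3 * x.1 * x.2 + x.2 * x.2

lemma invariant_eq_bracketNorm (D : PDCode) : invariant D = bracketNorm D := by
  have h := root_sq
  have h' : (3 - root) ^ 2 = 3 * (3 - root) - 1 := by linear_combination h
  rw [invariant, partition_eq_bracket h _ D D.cost_le, partition_eq_bracket h' _ D D.cost_le,
    bracketNorm]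
  push_cast
  linear_combination (-((bracket (3 * D.length) D).2 : ℝ) ^ 2) * h

/-! ### The invariant of twist knots and torus knots -/

section Rows

variable {K : Type*} [Field K]

/-- The two strands in a row of `n` half twists: a crossing is `1 - v * U`, where `U * U = 3 * U`,
so that `n` crossings are `1 + rowCoeff v n * U`. -/
def rowCoeff (v : K) : ℕ → K
  | 0 => 0
  | n + 1 => (1 - 3 * v) * rowCoeff v n - v

lemma three_mul_rowCoeff {v : K} (hv : v ^ 2 = 3 * v - 1) (n : ℕ) :
    3 * rowCoeff v n = (-v ^ 2) ^ n - 1 := by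
  induction n with
  | zero => simp [rowCoeff]
  | succ n ih =>
    rw [rowCoeff, pow_succ]
    linear_combination (1 - 3 * v) * ih + (-v ^ 2) ^ n * hv

variable [CharZero K]

/-- A row of `n` half twists, as in `twistDiagram`. -/
def row (n : ℕ) : PDCode :=
  (List.range n).map fun k => .X (2 * k + 2) (2 * k) (2 * k + 1) (2 * k + 3)

lemma row_succ (n : ℕ) :
    row (n + 1) = row n ++ [.X (2 * n + 2) (2 * n) (2 * n + 1) (2 * n + 3)] := by
  simp [row, List.range_succ]

lemma PDCode.map_subst_eq_self {D : PDCode} {a b : ℕ} (h : b ∉ D.labels) :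
    D.map (Node.relabel fun x => if x = b then a else x) = D := by
  induction D with
  | nil => rfl
  | cons n D ih =>
    rw [PDCode.labels_cons, List.mem_append, not_or] at h
    rw [List.map_cons, ih h.2]
    congr 1
    cases n with
    | X p q r s =>
      simp only [Node.ends, List.mem_cons, not_or] at h
      obtain ⟨⟨hp, hq, hr, hs, -⟩, -⟩ := h
      simp [Node.relabel, Ne.symm hp, Ne.symm hq, Ne.symm hr, Ne.symm hs]
    | P p q =>
      simp only [Node.ends, List.mem_cons, not_or] at h
      obtain ⟨⟨hp, hq, -⟩, -⟩ := h
      simp [Node.relabel, Ne.symm hp, Ne.symm hq]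

/-- A mark between two different labels, of which the second does not occur in the rest of the
diagram, except in the second piece. -/
lemma partition_unmark_cons (v : K) {D : PDCode} (n : Node) {a b : ℕ} (hab : a ≠ b)
    (hD : b ∉ D.labels) :
    partition v (.P a b :: n :: D) =
      partition v (n.relabel (fun x => if x = b then a else x) :: D) := by
  rw [partition_unmark v _ hab, List.map_cons, PDCode.map_subst_eq_self hD]

/-- Adding a crossing to two strands without crossing. -/
lemma partition_row_join (v : K) {C : PDCode} {x y m m' r s : ℕ}
    (hm : m ∉ [x, y, m', r, s] ++ C.labels) (hm' : m' ∉ [x, y, r, s] ++ C.labels) :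
    partition v (.P x m :: .P y m' :: .X r m m' s :: C) =
      partition v (.P x r :: .P y s :: C) - v * partition v (.P x y :: .P r s :: C) := by
  simp only [List.cons_append, List.nil_append, List.mem_cons, not_or, ← ne_eq] at hm hm'
  obtain ⟨hx, hy, hmm, hr, hs, hC⟩ := hm
  obtain ⟨hx', hy', hr', hs', hC'⟩ := hm'
  rw [partition_perm v (List.Perm.swap (.P y m') (.P x m) _),
    partition_perm v ((List.Perm.swap (.X r m m' s) (.P x m) C).cons _),
    partition_unmark_cons v _ hy'.symm (by
      simpa [Node.ends, hmm.symm, hx'] using hC')]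
  simp only [Node.relabel, hmm, hr'.symm, hs'.symm, if_false, if_true]
  rw [partition_perm v (List.Perm.swap (.P x m) (.X r m y s) _),
    partition_unmark_cons v _ hx.symm hC]
  simp only [Node.relabel, hr.symm, hy.symm, hs.symm, if_false, if_true]
  rw [partition_crossing, partition_turnP v _ r x,
    partition_perm v (List.Perm.swap (.P x y) (.P r s) C)]

/-- Adding a crossing to two strands that turn back. -/
lemma partition_row_curl (v : K) {C : PDCode} {x y m m' r s : ℕ}
    (hm : m ∉ [x, y, m', r, s] ++ C.labels) (hm' : m' ∉ [x, y, r, s] ++ C.labels) :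
    partition v (.P x y :: .P m m' :: .X r m m' s :: C) =
      (1 - 3 * v) * partition v (.P x y :: .P r s :: C) := by
  simp only [List.cons_append, List.nil_append, List.mem_cons, not_or, ← ne_eq] at hm hm'
  obtain ⟨hx, hy, hmm, hr, hs, hC⟩ := hm
  obtain ⟨hx', hy', hr', hs', hC'⟩ := hm'
  rw [partition_perm v (List.Perm.swap (.P m m') (.P x y) _),
    partition_perm v ((List.Perm.swap (.X r m m' s) (.P x y) C).cons _),
    partition_unmark_cons v _ hmm (by simpa [Node.ends, hx', hy'] using hC')]
  simp only [Node.relabel, hmm, hr'.symm, hs'.symm, if_false, if_true]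
  rw [partition_r1_switched hr.symm hs.symm (by simpa [Node.ends, hx, hy] using hC),
    partition_perm v (List.Perm.swap (.P x y) (.P r s) C)]

/-- Expansion of a row of half twists whose inner labels do not occur in the rest `C` of the
diagram. -/
lemma partition_row (v : K) (n : ℕ) (C : PDCode)
    (hC : ∀ l ∈ C.labels, l < 2 ∨ 2 * (n + 1) ≤ l) :
    partition v (row (n + 1) ++ C) =
      partition v (.P 0 (2 * (n + 1)) :: .P 1 (2 * (n + 1) + 1) :: C) +
        rowCoeff v (n + 1) *
          partition v (.P 0 1 :: .P (2 * (n + 1)) (2 * (n + 1) + 1) :: C) := by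
  induction n generalizing C with
  | zero =>
    have h : row 1 ++ C = .X 2 0 1 3 :: C := rfl
    rw [h, partition_crossing, partition_turnP v _ 2 0]
    simp only [rowCoeff]
    rw [partition_perm v (List.Perm.swap (Node.P 0 1) (Node.P 2 3) C)]
    ring
  | succ n ih =>
    have hlt {l : ℕ} (h2 : 2 ≤ l) (hl : l < 2 * (n + 1 + 1)) : l ∉ C.labels := fun h => by
      have := hC l h; omega
    rw [row_succ, List.append_assoc, List.singleton_append, ih]
    · set m := 2 * (n + 1) with hm
      have e1 : 2 * (n + 1 + 1) = m + 2 := by omega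
      have h0 : m ∉ C.labels := hlt (by omega) (by omega)
      have h1 : m + 1 ∉ C.labels := hlt (by omega) (by omega)
      have hm' : m ∉ [0, 1, m + 1, m + 2, m + 3] ++ C.labels := by
        simp only [List.cons_append, List.nil_append, List.mem_cons, not_or]
        refine ⟨?_, ?_, ?_, ?_, ?_, h0⟩ <;> omega
      have hm'' : m + 1 ∉ [0, 1, m + 2, m + 3] ++ C.labels := by
        simp only [List.cons_append, List.nil_append, List.mem_cons, not_or]
        refine ⟨?_, ?_, ?_, ?_, h1⟩ <;> omega
      rw [e1, partition_row_join v hm' hm'', partition_row_curl v hm' hm'']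
      rw [show rowCoeff v (n + 1 + 1) = (1 - 3 * v) * rowCoeff v (n + 1) - v from rfl]
      ring
    · intro l hl
      simp only [PDCode.labels_cons, Node.ends, List.mem_append, List.mem_cons, List.not_mem_nil,
        or_false] at hl
      rcases hl with hl | hl
      · omega
      · have := hC l hl; omega

/-- `partition_row` for a diagram whose rest is `C` with the labels `2, 3, …` shifted. -/
lemma partition_row_rename (v : K) (n : ℕ) (C : PDCode) :
    partition v (row (n + 1) ++ C.map (Node.relabel fun x => if x < 2 then x else x + 2 * n)) =
      partition v (.P 0 2 :: .P 1 3 :: C) +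
        rowCoeff v (n + 1) * partition v (.P 0 1 :: .P 2 3 :: C) := by
  set g : ℕ → ℕ := fun x => if x < 2 then x else x + 2 * n with hg
  have hinj : Function.Injective g := fun x y h => by
    simp only [hg] at h
    split_ifs at h <;> omega
  rw [partition_row, ← partition_rename v (.P 0 2 :: .P 1 3 :: C) g hinj,
    ← partition_rename v (.P 0 1 :: .P 2 3 :: C) g hinj]
  · simp only [List.map_cons, Node.relabel]
    have h2 : g 2 = 2 * (n + 1) := by simp [hg]; ring
    have h3 : g 3 = 2 * (n + 1) + 1 := by simp [hg]; ring
    rw [h2, h3]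
    rfl
  · intro l hl
    rw [PDCode.labels_relabel, List.mem_map] at hl
    obtain ⟨x, -, rfl⟩ := hl
    simp only [hg]
    split_ifs <;> omega

lemma partition_twistDiagram {v : K} (hv : v ^ 2 = 3 * v - 1) (n : ℕ) :
    partition v (twistDiagram (n + 1)) = 24 - 16 * v + 7 * v * (-v ^ 2) ^ (n + 1) := by
  have h : twistDiagram (n + 1) = row (n + 1) ++
      ([.X 3 1 5 4, .X 4 5 0 2] : PDCode).map
        (Node.relabel fun x => if x < 2 then x else x + 2 * n) := by
    rw [twistDiagram, row]
    congr 1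
    simp [Node.relabel]
    omega
  rw [h, partition_row_rename, partition_eq_bracket hv 8 _ le_rfl,
    partition_eq_bracket hv 8 _ le_rfl]
  have h1 : bracket 8 [.P 0 2, .P 1 3, .X 3 1 5 4, .X 4 5 0 2] = (24, -9) := by decide
  have h2 : bracket 8 [.P 0 1, .P 2 3, .X 3 1 5 4, .X 4 5 0 2] = (0, 21) := by decide
  rw [h1, h2]
  push_cast
  linear_combination 7 * v * three_mul_rowCoeff hv (n + 1)

lemma partition_torusDiagram {v : K} (hv : v ^ 2 = 3 * v - 1) (n : ℕ) :
    partition v (torusDiagram (n + 2)) = 8 + (-v ^ 2) ^ (n + 2) := by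
  have h : torusDiagram (n + 2) = row (n + 1) ++
      ([.X 0 2 3 1] : PDCode).map
        (Node.relabel fun x => if x < 2 then x else x + 2 * n) := by
    rw [torusDiagram, List.range_succ, List.map_append, row]
    congr 1
    · refine List.map_congr_left fun k hk => ?_
      have := List.mem_range.1 hk
      rw [Nat.mod_eq_of_lt (by omega), Nat.mod_eq_of_lt (by omega)]
    · have e1 : 2 * (n + 1) + 2 = 2 * (n + 2) := by ring
      have e2 : 2 * (n + 1) + 3 = 1 + 2 * (n + 2) := by ring
      simp only [List.map_cons, List.map_nil, Node.relabel]
      rw [e1, e2, Nat.mod_self, Nat.add_mod_right, Nat.mod_eq_of_lt (by omega)]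
      simp
      omega
  rw [h, partition_row_rename, partition_eq_bracket hv 5 _ le_rfl,
    partition_eq_bracket hv 5 _ le_rfl]
  have h1 : bracket 5 [.P 0 2, .P 1 3, .X 0 2 3 1] = (9, -3) := by decide
  have h2 : bracket 5 [.P 0 1, .P 2 3, .X 0 2 3 1] = (3, -9) := by decide
  rw [h1, h2, pow_succ _ (n + 1)]
  push_cast
  linear_combination (1 - 3 * v) * three_mul_rowCoeff hv (n + 1) + (-v ^ 2) ^ (n + 1) * hv

end Rows

/-- The invariant of the twist knot with `n` twists. -/
def twistNorm : ℕ → ℤ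
  | 0 => 9
  | 1 => -2511
  | n + 2 => -7 * twistNorm (n + 1) - twistNorm n - 2439

/-- The invariant of the `(2, p)` torus knot. -/
def torusNorm : ℕ → ℤ
  | 0 => 81
  | 1 => 9
  | n + 2 => -7 * torusNorm (n + 1) - torusNorm n + 585

/-- A sequence that satisfies a recurrence with characteristic roots `-u ^ 2` and `-(3 - u) ^ 2`. -/
lemma eq_of_recurrence {a : ℕ → ℤ} {c : ℤ} (ha : ∀ n, a (n + 2) = -7 * a (n + 1) - a n + 9 * c)
    {v p q : ℝ} (hv : v ^ 2 = 3 * v - 1) (h0 : a 0 = c + p + q)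
    (h1 : a 1 = c - p * v ^ 2 - q * (3 - v) ^ 2) (n : ℕ) :
    (a n : ℝ) = c + p * (-v ^ 2) ^ n + q * (-(3 - v) ^ 2) ^ n := by
  induction n using Nat.twoStepInduction with
  | zero => rw [h0]; ring
  | one => rw [h1]; ring
  | more n ih ih' =>
    have hx : (-v ^ 2) ^ 2 = -7 * -v ^ 2 - 1 := by linear_combination (v ^ 2 + 3 * v + 1) * hv
    have hy : (-(3 - v) ^ 2) ^ 2 = -7 * -(3 - v) ^ 2 - 1 := by
      linear_combination ((3 - v) ^ 2 + 3 * (3 - v) + 1) * hv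
    rw [ha, pow_add, pow_add _ n 2, hx, hy]
    push_cast
    rw [ih, ih']
    ring

lemma root_mul_pow (n : ℕ) : (-root ^ 2) ^ n * (-(3 - root) ^ 2) ^ n = 1 := by
  have h := root_sq
  rw [← mul_pow, show -root ^ 2 * -(3 - root) ^ 2 = 1 by
    linear_combination (root * (3 - root) + 1) * (-h), one_pow]

lemma invariant_twistDiagram {n : ℕ} (hn : 1 ≤ n) : invariant (twistDiagram n) = twistNorm n := by
  obtain ⟨n, rfl⟩ := Nat.exists_eq_add_of_le' hn
  have h := root_sq
  have h' : (3 - root) ^ 2 = 3 * (3 - root) - 1 := by linear_combination h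
  rw [invariant, partition_twistDiagram h, partition_twistDiagram h',
    eq_of_recurrence (c := -271) (p := 7 * (24 * root - 16)) (q := 7 * (24 * (3 - root) - 16))
      (fun n => by rw [twistNorm]; ring) h (by simp [twistNorm]; ring)]
  · push_cast
    linear_combination 49 * root * (3 - root) * root_mul_pow (n + 1) +
      (- 256 + 7 * 16 * (-root ^ 2) ^ (n + 1) + 7 * 16 * (-(3 - root) ^ 2) ^ (n + 1) - 49) * h
  · simp [twistNorm]
    linear_combination 1288 * h

lemma invariant_torusDiagram {p : ℕ} (hp : 2 ≤ p) : invariant (torusDiagram p) = torusNorm p := by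
  obtain ⟨n, rfl⟩ := Nat.exists_eq_add_of_le' hp
  have h := root_sq
  have h' : (3 - root) ^ 2 = 3 * (3 - root) - 1 := by linear_combination h
  rw [invariant, partition_torusDiagram h, partition_torusDiagram h',
    eq_of_recurrence (c := 65) (p := 8) (q := 8)
      (fun n => by rw [torusNorm]; ring) h (by simp [torusNorm]; ring)]
  · push_cast
    linear_combination root_mul_pow (n + 2)
  · simp [torusNorm]
    linear_combination 16 * h

/-- Bounds on the absolute values of a sequence with alternating signs. -/
lemma le_abs_of_recurrence {a : ℕ → ℤ} {c B : ℤ} {k : ℕ}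
    (ha : ∀ n, a (n + 2) = -7 * a (n + 1) - a n + c) (hB : |c| ≤ B)
    (h0 : B ≤ |a k|) (h1 : |a k| ≤ |a (k + 1)|) {n : ℕ} (hn : k ≤ n) : B ≤ |a n| := by
  have h (m : ℕ) : B ≤ |a (k + m)| ∧ |a (k + m)| ≤ |a (k + m + 1)| := by
    induction m with
    | zero => exact ⟨h0, h1⟩
    | succ m ih =>
      refine ⟨ih.1.trans ih.2, ?_⟩
      have := ha (k + m)
      rw [show k + (m + 1) + 1 = k + m + 2 by ring, show k + (m + 1) = k + m + 1 by ring]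
      obtain ⟨h2, h3⟩ := ih
      rw [this]
      generalize a (k + m) = x at *
      generalize a (k + m + 1) = y at *
      have e1 : |7 * y| ≤ |-7 * y - x + c| + |x| + |c| := by
        calc |7 * y| = |(-7 * y - x + c) + x - c| * 1 := by rw [mul_one, ← abs_neg]; congr 1; ring
          _ ≤ _ := by rw [mul_one]; exact (abs_sub _ _).trans (by gcongr; exact abs_add_le _ _)
      rw [abs_mul, show |(7 : ℤ)| = 7 by norm_num] at e1
      have := abs_nonneg x
      linarith
  obtain ⟨m, rfl⟩ := Nat.exists_eq_add_of_le hn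
  exact (h m).1

/-- Twist knots with at least seven twists have large invariants. -/
lemma le_abs_twistNorm {n : ℕ} (hn : 7 ≤ n) : 10 ^ 8 ≤ |twistNorm n| :=
  le_abs_of_recurrence (k := 7) (c := -2439) (fun n => by rw [twistNorm]; ring)
    (by norm_num) (by decide) (by decide) hn

lemma le_abs_torusNorm {p : ℕ} (hp : 9 ≤ p) : 10 ^ 8 ≤ |torusNorm p| :=
  le_abs_of_recurrence (k := 9) (c := 585) (fun n => by rw [torusNorm])
    (by norm_num) (by decide) (by decide) hp

/-! ### Recognizing knot diagrams -/

/-- Entry number `i` of a table with entries below `256`, which is stored as a number in base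
`256`. Only arithmetic on numerals is needed to read an entry. -/
def entry (T i : ℕ) : ℕ := Nat.mod (Nat.shiftRight T (Nat.mul 8 i)) 256

/-- Write the entry number `i`, which has to be zero before, of a table. -/
def setEntry (T i x : ℕ) : ℕ := Nat.lor T (Nat.shiftLeft x (Nat.mul 8 i))

/-- What has to be known about an end `x` of a piece: its number, its label, the number of the next
end counterclockwise, and the number of the opposite end. -/
structure EndInfo where
  code : ℕ
  label : ℕ
  next : ℕ
  opposite : ℕ

/-- The data of all ends of a diagram, numbered from `k` on. -/
def endTable : ℕ → PDCode → List EndInfo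
  | _, [] => []
  | k, .X a b c d :: D => ⟨k, a, k + 1, k + 2⟩ :: ⟨k + 1, b, k + 2, k + 3⟩ ::
      ⟨k + 2, c, k + 3, k⟩ :: ⟨k + 3, d, k, k + 1⟩ :: endTable (k + 4) D
  | k, .P a b :: D => ⟨k, a, k + 1, k + 1⟩ :: ⟨k + 1, b, k, k⟩ :: endTable (k + 2) D

/-- A table with one entry for each end. -/
def tabulate (g : EndInfo → ℕ) (t : List EndInfo) : ℕ :=
  t.foldr (fun e T => setEntry T e.code (g e)) 0

/-- Two tables that list, for each label, the (at most two) ends with this label, as one plus the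
number of the end. -/
def endsOfLabels (t : List EndInfo) : ℕ × ℕ :=
  t.foldr (fun e p => bif Nat.beq (entry p.1 e.label) 0
    then (setEntry p.1 e.label (e.code + 1), p.2)
    else (p.1, setEntry p.2 e.label (e.code + 1))) (0, 0)

/-- The other end with label `l`, apart from the end `c`. -/
def otherEnd (A B l c : ℕ) : ℕ :=
  bif Nat.beq (entry A l) (c + 1) then Nat.pred (entry B l) else Nat.pred (entry A l)

/-- The table of the ends that are joined by an edge to the ends in the list. -/
def partners (t : List EndInfo) : ℕ :=
  let ab := endsOfLabels t
  tabulate (fun e => otherEnd ab.1 ab.2 e.label e.code) t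

/-- Walk once around a face, starting at the end `x`. The first table records `x` as the
representative of the face, the second one a rank that decreases along the walk. -/
def walkFace (F x : ℕ) : ℕ → ℕ → ℕ × ℕ → ℕ × ℕ
  | 0, _, p => p
  | r + 1, y, p =>
    let p' := (setEntry p.1 y x, setEntry p.2 y (r + 1))
    bif Nat.beq (entry F y) x then p' else walkFace F x r (entry F y) p'

/-- Representatives and ranks for all faces. -/
def faceTables (F : ℕ) (t : List EndInfo) : ℕ × ℕ :=
  t.foldr (fun e p => bif Nat.beq (entry p.2 e.code) 0 then walkFace F e.code 255 e.code p else p)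
    (0, 0)

/-- Walk along the knot, from the end `y` on, and record the rank of the ends on the way. -/
def walkStrand (P O : ℕ) : ℕ → ℕ → ℕ → ℕ → ℕ
  | 0, _, _, S => S
  | n + 1, y, r, S => walkStrand P O n (entry O (entry P y)) (r + 2)
      (setEntry (setEntry S y r) (entry P y) (r + 1))

/-- The conditions on the end `e` under which the tables prove that the diagram is a knot diagram.
* `L` is the table of labels, `A` and `B` list the ends with a given label, and `P` is the table of
  the ends joined by an edge.
* `C` is constant on faces, and the rank `R` decreases on the way to the representative.
* The rank `S` decreases along the knot on the way to the end number `0`. -/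
def certifiedEnd (N L A B P C R S : ℕ) (e : EndInfo) : Bool :=
  let p := entry P e.code
  Nat.beq (entry L e.code) e.label && Nat.beq (entry L p) e.label &&
  (Nat.beq (entry A e.label) (e.code + 1) || Nat.beq (entry B e.label) (e.code + 1)) &&
  Nat.beq p (otherEnd A B e.label e.code) && !(Nat.beq p e.code) && Nat.blt p N &&
  Nat.beq (entry C e.next) (entry C p) &&
  (Nat.beq (entry C p) p || Nat.beq (entry C p) e.next ||
    Nat.blt (entry R e.next) (entry R p)) &&
  (Nat.beq e.code 0 || Nat.blt (entry S p) (entry S e.code) ||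
    Nat.blt (entry S e.opposite) (entry S e.code))

/-- The certificate for a diagram with `V` pieces and the list `t` of ends. -/
def certified (V L A B P C R S : ℕ) (t : List EndInfo) : Bool :=
  t.all (certifiedEnd t.length L A B P C R S) &&
  Nat.beq (2 * V + 2 * t.countP fun e => Nat.beq (entry C e.code) e.code) (t.length + 4)

/-- A test for knot diagrams: the tables are computed and checked. -/
def isKnot (D : PDCode) : Bool :=
  let t := endTable 0 D
  let ab := endsOfLabels t
  let P := partners t
  let O := tabulate (·.opposite) t
  let T := tabulate (·.next) t
  let cr := faceTables (tabulate (fun e => entry T (entry P e.code)) t) t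
  certified D.length (tabulate (·.label) t) ab.1 ab.2 P cr.1 cr.2
    (walkStrand P O (t.length / 2) 0 1 0) t

lemma mem_endTable (D : PDCode) (k : ℕ) (x : D.Dart) :
    (⟨k + D.code x, D.label x, k + D.code (D.turn 1 x),
      k + D.code (D.turn ((D.get x.1).ends.length / 2) x)⟩ : EndInfo) ∈ endTable k D := by
  induction D generalizing k with
  | nil => exact x.1.elim0
  | cons n D ih =>
    cases x using PDCode.dart_cases with
    | head j =>
      change (⟨k + j, n.ends.get j, k + (j + 1) % n.ends.length,
        k + (j + n.ends.length / 2) % n.ends.length⟩ : EndInfo) ∈ endTable k (n :: D)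
      cases n <;> fin_cases j <;> simp [endTable, Node.ends]
    | tail x =>
      have := ih (k + n.ends.length) x
      rw [Nat.add_assoc, Nat.add_assoc, Nat.add_assoc] at this
      cases n with
      | X a b c d =>
        exact List.mem_cons_of_mem _ (List.mem_cons_of_mem _ (List.mem_cons_of_mem _
            (List.mem_cons_of_mem _ this)))
      | P a b => exact List.mem_cons_of_mem _ (List.mem_cons_of_mem _ this)

lemma endTable_map_code (D : PDCode) (k : ℕ) :
    (endTable k D).map EndInfo.code = List.range' k D.labels.length := by
  induction D generalizing k with
  | nil => rfl
  | cons n D ih =>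
    cases n with
    | X a b c d =>
      simp [endTable, PDCode.labels_cons, Node.ends, ih, List.range'_succ, Nat.add_assoc]
    | P a b => simp [endTable, PDCode.labels_cons, Node.ends, ih, List.range'_succ, Nat.add_assoc]

lemma length_endTable (D : PDCode) (k : ℕ) : (endTable k D).length = D.labels.length := by
  rw [← List.length_map EndInfo.code, endTable_map_code, List.length_range']

/-- The number of ends with a property of their numbers. -/
lemma card_dart_eq_countP (D : PDCode) (p : ℕ → Bool) :
    Nat.card {x : D.Dart // p (D.code x)} = (endTable 0 D).countP fun e => p e.code := by
  have h : (endTable 0 D).countP (fun e => p e.code) =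
      ((endTable 0 D).map EndInfo.code).countP p := by rw [List.countP_map]; rfl
  rw [h, endTable_map_code, ← List.range_eq_range', ← List.map_coe_finRange_eq_range,
    List.countP_map, List.countP_eq_length_filter]
  have e : {x : D.Dart // p (D.code x)} ≃ {c : Fin D.labels.length // p c} :=
    D.dartEquiv.subtypeEquiv fun x => Iff.rfl
  rw [Nat.card_congr e, Nat.card_eq_fintype_card, Fintype.card_subtype]
  change ((List.finRange D.labels.length).filter fun c : Fin _ => decide (p c = true)).length = _
  simp [Function.comp_def]

/-- The orbits of a map `f` are counted by representatives, if `c` is constant on orbits and a rank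
decreases along `f` until a representative is reached. -/
lemma card_quot_eq {α : Type*} (f : α → α) (code c r : α → ℕ) (hcode : Function.Injective code)
    (hc : ∀ x, c (f x) = c x)
    (hr : ∀ x, c x = code x ∨ c x = code (f x) ∨ r (f x) < r x) :
    Nat.card (Quot fun x y => y = f x) = Nat.card {x // c x = code x} := by
  have step (x : α) : (Quot.mk (fun x y => y = f x) x) = Quot.mk _ (f x) := Quot.sound rfl
  let q : {x // c x = code x} → Quot fun x y => y = f x := fun x => Quot.mk _ x.1
  refine (Nat.card_congr (Equiv.ofBijective q ⟨?_, ?_⟩)).symm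
  · intro x y h
    have : c x = c y := congrArg (Quot.lift c fun a b hab => by rw [hab, hc]) h
    exact Subtype.ext (hcode (by rw [← x.2, ← y.2, this]))
  · intro y
    induction y using Quot.ind with | mk x => ?_
    induction h : r x using Nat.strong_induction_on generalizing x with | h n ih => ?_
    rcases hr x with hx | hx | hx
    · exact ⟨⟨x, hx⟩, rfl⟩
    · exact ⟨⟨f x, by rw [hc, hx]⟩, (step x).symm⟩
    · obtain ⟨z, hz⟩ := ih _ (h ▸ hx) (f x) rfl
      exact ⟨z, hz.trans (step x).symm⟩

lemma isKnotDiagram_of_certified {D : PDCode} {L A B P C R S : ℕ}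
    (h : certified D.length L A B P C R S (endTable 0 D)) : D.IsKnotDiagram := by
  rw [certified, Bool.and_eq_true, List.all_eq_true, length_endTable] at h
  obtain ⟨h, hcount⟩ := h
  have hx (x : D.Dart) := h _ (mem_endTable D 0 x)
  simp only [certifiedEnd, Bool.and_eq_true, Bool.or_eq_true, Nat.beq_eq, Nat.blt_eq, Nat.zero_add,
    Bool.not_eq_true'] at hx
  have hex (x : D.Dart) : ∃ y, D.code y = entry P (D.code x) :=
    D.exists_code_eq (by have := hx x; tauto)
  choose p hp using hex
  have hjoin (x y : D.Dart) : D.Joined x y ↔ y = p x := by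
    have hl : D.label (p x) = D.label x := by
      have h1 := (hx (p x)).1.1.1.1.1.1.1.1
      have h2 := (hx x).1.1.1.1.1.1.1.2
      rw [hp] at h1
      exact h1.symm.trans h2
    have hne : D.code (p x) ≠ D.code x := by
      rw [hp]
      exact fun h => by simpa [h] using (hx x).1.1.1.1.2
    constructor
    · rintro ⟨hxy, hlab⟩
      have h1 := (hx x).1.1.1.1.1.1.2
      have h2 := (hx y).1.1.1.1.1.1.2
      have h3 := (hx x).1.1.1.1.1.2
      have hc : D.code y ≠ D.code x := fun h => hxy (D.code_injective h).symm
      rw [← hlab] at h2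
      rw [← hp, otherEnd] at h3
      refine D.code_injective ?_
      rw [h3]
      by_cases hA : entry A (D.label x) = D.code x + 1
      · rw [hA, Nat.beq_refl, cond_true]
        rcases h2 with h2 | h2
        · omega
        · rw [h2]; rfl
      · rw [beq_eq_false_of_ne hA, cond_false]
        rcases h2 with h2 | h2
        · rw [h2]; rfl
        · omega
    · rintro rfl
      exact ⟨fun h => hne (by rw [← h]), hl.symm⟩
  have hpp (x : D.Dart) : p (p x) = x := by
    have := (hjoin x (p x)).2 rfl
    exact ((hjoin _ _).1 ⟨this.1.symm, this.2.symm⟩).symm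
  have hface : D.FaceStep = fun x y => y = D.turn 1 (p x) := by
    funext x y
    simp [PDCode.FaceStep, hjoin]
  refine ⟨fun x => ⟨p x, (hjoin x _).2 rfl, fun y => (hjoin x y).1⟩, ?_, ?_⟩
  · obtain ⟨x₀, hx₀⟩ : ∃ x, D.code x = 0 := D.exists_code_eq <| by
      cases D with
      | nil => simp [PDCode.labels, endTable] at hcount
      | cons n D => cases n <;> simp [Node.ends]
    have hstrand (x : D.Dart) : Quot.mk D.StrandStep x = Quot.mk _ x₀ := by
      induction h : entry S (D.code x) using Nat.strong_induction_on generalizing x with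
      | h n ih => ?_
      rcases (hx x).2 with (hx0 | hS) | hS
      · rw [D.code_injective (hx0.trans hx₀.symm)]
      · rw [← hp] at hS
        rw [← ih _ (h ▸ hS) (p x) rfl]
        exact Quot.sound (.inl ((hjoin x _).2 rfl))
      · rw [← ih _ (h ▸ hS) _ rfl]
        exact Quot.sound (.inr rfl)
    rw [Nat.card_eq_one_iff_unique]
    exact ⟨⟨fun a b => by
      induction a using Quot.ind
      induction b using Quot.ind
      exact (hstrand _).trans (hstrand _).symm⟩, ⟨Quot.mk _ x₀⟩⟩
  · rw [hface, card_quot_eq (fun x => D.turn 1 (p x)) D.code (fun x => entry C (D.code x))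
      (fun x => entry R (D.code x)) D.code_injective, D.card_dart]
    · have := card_dart_eq_countP D (fun c => Nat.beq (entry C c) c)
      simp only [Nat.beq_eq] at this hcount
      rw [this, hcount]
    · intro x
      have := hx (p x)
      rw [← hp, hpp] at this
      tauto
    · intro x
      have := hx (p x)
      rw [← hp, hpp] at this
      tauto

lemma isKnotDiagram_of_isKnot {D : PDCode} (h : isKnot D) : D.IsKnotDiagram :=
  isKnotDiagram_of_certified h

/-! ### Changing the code of a diagram -/

/-- The codes `D` and `D'` differ in the order of the pieces, the end at which a piece is read off,
and the names of the edges, which are changed by `f`. -/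
def Similar (f : ℕ → ℕ) (D D' : PDCode) : Prop :=
  D.length = D'.length ∧ ∃ e : D.Dart ≃ D'.Dart, ∀ x, D'.label (e x) = f (D.label x) ∧
    (D'.get (e x).1).ends.length = (D.get x.1).ends.length ∧
    ∀ k, e (D.turn k x) = D'.turn k (e x)

lemma Similar.isKnotDiagram {f : ℕ → ℕ} {D D' : PDCode} (h : Similar f D D')
    (hf : Function.Injective f) (hD : D.IsKnotDiagram) : D'.IsKnotDiagram := by
  obtain ⟨hlen, e, he⟩ := h
  have hlab (x) : D'.label (e x) = f (D.label x) := (he x).1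
  have hends (x) := (he x).2.1
  have hturn (k x) : e (D.turn k x) = D'.turn k (e x) := (he x).2.2 k
  have hj (x y : D.Dart) : D.Joined x y ↔ D'.Joined (e x) (e y) := by
    simp [PDCode.Joined, hlab, hf.eq_iff]
  have hs (x y : D.Dart) : D.StrandStep x y ↔ D'.StrandStep (e x) (e y) := by
    rw [PDCode.StrandStep, PDCode.StrandStep, hj, hends, ← hturn, e.apply_eq_iff_eq]
  have hF (x y : D.Dart) : D.FaceStep x y ↔ D'.FaceStep (e x) (e y) := by
    rw [PDCode.FaceStep, PDCode.FaceStep, ← e.exists_congr_right]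
    simp only [hj, ← hturn, e.apply_eq_iff_eq]
  refine ⟨fun x => ?_, ?_, ?_⟩
  · obtain ⟨x, rfl⟩ := e.surjective x
    obtain ⟨y, hy, huniq⟩ := hD.edges x
    refine ⟨e y, (hj x y).1 hy, fun z hz => ?_⟩
    obtain ⟨z, rfl⟩ := e.surjective z
    rw [huniq z ((hj x z).2 hz)]
  · rw [← hD.one_component]
    exact (Nat.card_congr (Quot.congr e hs)).symm
  · rw [← hlen, ← Nat.card_congr (Quot.congr e hF), ← Nat.card_congr e]
    exact hD.planar

lemma Similar.refl (D : PDCode) : Similar id D D :=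
  ⟨rfl, Equiv.refl _, fun _ => ⟨rfl, rfl, fun _ => rfl⟩⟩

lemma Similar.trans {f : ℕ → ℕ} {D D' D'' : PDCode} (h : Similar id D D') (h' : Similar f D' D'') :
    Similar f D D'' := by
  obtain ⟨hl, e, he⟩ := h
  obtain ⟨hl', e', he'⟩ := h'
  refine ⟨hl.trans hl', e.trans e', fun x => ⟨?_, ?_, fun k => ?_⟩⟩
  · rw [Equiv.trans_apply, (he' _).1, (he _).1, id]
  · rw [Equiv.trans_apply, (he' _).2.1, (he _).2.1]
  · rw [Equiv.trans_apply, Equiv.trans_apply, (he _).2.2, (he' _).2.2]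

/-- The ends of a non-empty code are those of its first piece and those of the others. -/
def PDCode.consEquiv (n : Node) (D : PDCode) :
    Fin n.ends.length ⊕ D.Dart ≃ PDCode.Dart (n :: D) where
  toFun := Sum.elim (headDart n D) (tailDart n D)
  invFun x := match x with
    | ⟨⟨0, _⟩, j⟩ => .inl j
    | ⟨⟨i + 1, h⟩, j⟩ => .inr ⟨⟨i, Nat.lt_of_succ_lt_succ h⟩, j⟩
  left_inv x := by rcases x with x | x <;> rfl
  right_inv x := by cases x using PDCode.dart_cases <;> rfl

lemma Similar.cons {f : ℕ → ℕ} {D D' : PDCode} (h : Similar f D D') {n n' : Node}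
    (s : Fin n.ends.length ≃ Fin n'.ends.length) (hlen : n'.ends.length = n.ends.length)
    (hs : ∀ j, n'.ends.get (s j) = f (n.ends.get j))
    (ht : ∀ j k, (s j + k) % n'.ends.length =
      s ⟨(j + k) % n.ends.length, Nat.mod_lt _ (Nat.lt_of_le_of_lt (Nat.zero_le _) j.2)⟩) :
    Similar f (n :: D) (n' :: D') := by
  obtain ⟨hl, e, he⟩ := h
  refine ⟨by simp [hl], ((PDCode.consEquiv n D).symm.trans (s.sumCongr e)).trans
    (PDCode.consEquiv n' D'), fun x => ?_⟩
  cases x using PDCode.dart_cases with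
  | head j =>
    refine ⟨hs j, hlen, fun k => ?_⟩
    exact congrArg (PDCode.headDart n' D') (Fin.ext (ht j k).symm)
  | tail x =>
    refine ⟨(he x).1, (he x).2.1, fun k => ?_⟩
    exact congrArg (PDCode.tailDart n' D') ((he x).2.2 k)

lemma Similar.cons_self {D D' : PDCode} (h : Similar id D D') (n : Node) :
    Similar id (n :: D) (n :: D') :=
  h.cons (Equiv.refl _) rfl (fun _ => rfl) fun _ _ => rfl

lemma Similar.swap (m n : Node) (D : PDCode) : Similar id (m :: n :: D) (n :: m :: D) := by
  refine ⟨rfl, ((PDCode.consEquiv m (n :: D)).symm.trans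
    (((Equiv.refl _).sumCongr (PDCode.consEquiv n D).symm).trans
      (((Equiv.sumAssoc _ _ _).symm.trans ((Equiv.sumComm _ _).sumCongr (Equiv.refl _))).trans
        (Equiv.sumAssoc _ _ _)))).trans
    (((Equiv.refl _).sumCongr (PDCode.consEquiv m D)).trans (PDCode.consEquiv n (m :: D))),
    fun x => ?_⟩
  cases x using PDCode.dart_cases with
  | head j => exact ⟨rfl, rfl, fun _ => rfl⟩
  | tail x =>
    cases x using PDCode.dart_cases with
    | head j => exact ⟨rfl, rfl, fun _ => rfl⟩
    | tail x => exact ⟨rfl, rfl, fun _ => rfl⟩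

lemma similar_of_perm {D D' : PDCode} (h : D.Perm D') : Similar id D D' := by
  induction h with
  | nil => exact .refl _
  | cons n _ ih => exact ih.cons_self n
  | swap m n D => exact .swap n m D
  | trans _ _ ih ih' => exact ih.trans ih'

/-- Read off a crossing from the opposite end. -/
def Node.turned : Node → Node
  | .X a b c d => .X c d a b
  | .P a b => .P a b

lemma similar_turned (n : Node) (D : PDCode) : Similar id (n :: D) (n.turned :: D) := by
  cases n with
  | X a b c d =>
    let s : Fin 4 ≃ Fin 4 := Equiv.addRight 2
    have hval (j : Fin 4) : (s j : ℕ) = (j + 2) % 4 := by revert j; decide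
    refine (Similar.refl D).cons (n := .X a b c d) (n' := .X c d a b) s rfl (fun j => ?_)
      fun j k => ?_
    · change Fin 4 at j
      fin_cases j <;> rfl
    · change Fin 4 at j
      change ((s j : ℕ) + k) % 4 = (s ⟨(j + k) % 4, Nat.mod_lt _ (by norm_num)⟩ : ℕ)
      rw [hval, hval]
      change (((j : ℕ) + 2) % 4 + k) % 4 = ((j + k) % 4 + 2) % 4
      omega
  | P a b => exact .refl _

lemma similar_relabel (f : ℕ → ℕ) (D : PDCode) : Similar f D (D.map (Node.relabel f)) := by
  induction D with
  | nil => exact ⟨rfl, Equiv.refl _, fun x => x.1.elim0⟩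
  | cons n D ih =>
    cases n with
    | X a b c d =>
      refine ih.cons (n := .X a b c d) (n' := .X (f a) (f b) (f c) (f d)) (Equiv.refl (Fin 4)) rfl
        (fun j => ?_) fun _ _ => rfl
      change Fin 4 at j
      fin_cases j <;> rfl
    | P a b =>
      refine ih.cons (n := .P a b) (n' := .P (f a) (f b)) (Equiv.refl (Fin 2)) rfl
        (fun j => ?_) fun _ _ => rfl
      change Fin 2 at j
      fin_cases j <;> rfl

/-- The code `D'` is obtained from `D` by reordering the pieces and reading off crossings from the
opposite end. -/
def Rearranged : PDCode → PDCode → Prop :=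
  Relation.ReflTransGen fun D D' => D.Perm D' ∨ ∃ n E, D = n :: E ∧ D' = n.turned :: E

lemma rearranged_of_perm {D D' : PDCode} (h : D.Perm D') : Rearranged D D' := .single (.inl h)

lemma rearranged_turned (n : Node) (D : PDCode) : Rearranged (n :: D) (n.turned :: D) :=
  .single (.inr ⟨n, D, rfl, rfl⟩)

lemma Rearranged.cons {D D' : PDCode} (h : Rearranged D D') (m : Node) :
    Rearranged (m :: D) (m :: D') := by
  induction h with
  | refl => exact .refl
  | tail _ h ih =>
    refine ih.trans ?_
    rcases h with h | ⟨n, E, rfl, rfl⟩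
    · exact rearranged_of_perm (h.cons m)
    · exact ((rearranged_of_perm (.swap n m E)).trans (rearranged_turned n _)).trans
        (rearranged_of_perm (.swap m n.turned E))

lemma SameKnot.refl (D : PDCode) : SameKnot D D := Relation.EqvGen.refl _

lemma SameKnot.symm {D D' : PDCode} (h : SameKnot D D') : SameKnot D' D :=
  Relation.EqvGen.symm _ _ h

lemma SameKnot.trans {D D' D'' : PDCode} (h : SameKnot D D') (h' : SameKnot D' D'') :
    SameKnot D D'' :=
  Relation.EqvGen.trans _ _ _ h h'

lemma SameKnot.of_move {D D' : PDCode} (hD : D.IsKnotDiagram) (hD' : D'.IsKnotDiagram)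
    (h : Move D D') : SameKnot D D' := .rel _ _ ⟨hD, hD', h⟩

lemma Rearranged.sameKnot {D D' : PDCode} (h : Rearranged D D') (hD : D.IsKnotDiagram) :
    D'.IsKnotDiagram ∧ SameKnot D D' := by
  induction h with
  | refl => exact ⟨hD, SameKnot.refl _⟩
  | @tail E E' _ h ih =>
    obtain ⟨hE, hDE⟩ := ih
    rcases h with h | ⟨n, E, rfl, rfl⟩
    · have hE' := (similar_of_perm h).isKnotDiagram Function.injective_id hE
      exact ⟨hE', hDE.trans (SameKnot.of_move hE hE' (.reorder h))⟩
    · have hE' := (similar_turned n E).isKnotDiagram Function.injective_id hE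
      refine ⟨hE', hDE.trans ?_⟩
      cases n with
      | X a b c d => exact SameKnot.of_move hE hE' (.turnX E a b c d)
      | P a b => exact SameKnot.refl _

/-! ### Simplifying a diagram -/

/-- All ways to bring a piece to the front of a code. -/
def picks : PDCode → List (Node × PDCode)
  | [] => []
  | n :: D => (n, D) :: (n.turned, D) :: (picks D).map fun p => (p.1, n :: p.2)

lemma rearranged_of_mem_picks {D : PDCode} {p : Node × PDCode} (h : p ∈ picks D) :
    Rearranged D (p.1 :: p.2) := by
  induction D generalizing p with
  | nil => simp [picks] at h
  | cons n D ih =>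
    simp only [picks, List.mem_cons, List.mem_map] at h
    rcases h with rfl | rfl | ⟨q, hq, rfl⟩
    · exact .refl
    · exact rearranged_turned n D
    · exact ((ih hq).cons n).trans (rearranged_of_perm (.swap q.1 n q.2))

/-- The results of first Reidemeister moves that remove a crossing. -/
def r1Results (D : PDCode) : List PDCode :=
  (picks D).filterMap fun p => match p.1 with
    | .X a b c d =>
      bif Nat.beq a b then some (.P c d :: p.2)
      else bif Nat.beq b c then some (.P a d :: p.2)
      else none
    | .P _ _ => none

/-- The results of second Reidemeister moves that remove two crossings. -/
def r2Results (D : PDCode) : List PDCode :=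
  (picks D).flatMap fun p => match p.1 with
    | .X a b e f => (picks p.2).filterMap fun q => match q.1 with
      | .X a' g h b' =>
        bif Nat.beq a a' && Nat.beq b b' then some (.P e h :: .P f g :: q.2) else none
      | .P _ _ => none
    | .P _ _ => []

/-- The results of third Reidemeister moves. -/
def r3Results (D : PDCode) : List PDCode :=
  (picks D).flatMap fun p => match p.1 with
    | .X u₀ u₂ x₀ y₂ => (picks p.2).flatMap fun q => match q.1 with
      | .X a b c d =>
        bif Nat.beq c u₀ then (picks q.2).filterMap fun r => match r.1 with
          | .X y₁ u₂' u₁ x₂ =>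
            bif Nat.beq u₂ u₂' && Nat.beq b u₁ then
              some (.X a x₂ u₀ u₂ :: .X u₀ y₁ x₀ u₁ :: .X u₁ y₂ d u₂ :: r.2)
            else none
          | .P _ _ => none
        else bif Nat.beq b u₀ then (picks q.2).filterMap fun r => match r.1 with
          | .X y₁ u₂' u₁ x₂ =>
            bif Nat.beq u₂ u₂' && Nat.beq a u₁ then
              some (.X d x₂ u₀ u₂ :: .X y₁ x₀ u₁ u₀ :: .X u₁ y₂ c u₂ :: r.2)
            else none
          | .P _ _ => none
        else []
      | .P _ _ => []
    | .P _ _ => []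

/-- `E` is obtained from `D` by rearranging the code and one elementary move. -/
def RearrangedMove (D E : PDCode) : Prop := ∃ D', Rearranged D D' ∧ Move D' E

lemma RearrangedMove.sameKnot {D E : PDCode} (h : RearrangedMove D E) (hD : D.IsKnotDiagram)
    (hE : E.IsKnotDiagram) : SameKnot D E := by
  obtain ⟨D', h, h'⟩ := h
  obtain ⟨hD', hDD'⟩ := h.sameKnot hD
  exact hDD'.trans (SameKnot.of_move hD' hE h')

lemma rearranged_of_mem_picks₂ {D : PDCode} {p q : Node × PDCode} (hp : p ∈ picks D)
    (hq : q ∈ picks p.2) : Rearranged D (p.1 :: q.1 :: q.2) :=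
  (rearranged_of_mem_picks hp).trans ((rearranged_of_mem_picks hq).cons p.1)

lemma rearranged_of_mem_picks₃ {D : PDCode} {p q r : Node × PDCode} (hp : p ∈ picks D)
    (hq : q ∈ picks p.2) (hr : r ∈ picks q.2) : Rearranged D (p.1 :: q.1 :: r.1 :: r.2) :=
  (rearranged_of_mem_picks₂ hp hq).trans (((rearranged_of_mem_picks hr).cons q.1).cons p.1)

lemma rearrangedMove_of_mem_r1Results {D E : PDCode} (h : E ∈ r1Results D) :
    RearrangedMove D E := by
  obtain ⟨⟨n, R⟩, hp, h⟩ := List.mem_filterMap.1 h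
  have hp := rearranged_of_mem_picks hp
  cases n with
  | P a b => simp at h
  | X a b c d =>
    simp only [Bool.cond_eq_ite, Nat.beq_eq] at h
    split_ifs at h with h1 h2
    · subst h1
      obtain rfl := Option.some_injective _ h
      exact ⟨_, hp, .r1 _ _ _ _⟩
    · subst h2
      obtain rfl := Option.some_injective _ h
      exact ⟨_, hp, .r1_switched _ _ _ _⟩

lemma rearrangedMove_of_mem_r2Results {D E : PDCode} (h : E ∈ r2Results D) :
    RearrangedMove D E := by
  obtain ⟨⟨n, R⟩, hp, h⟩ := List.mem_flatMap.1 h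
  cases n with
  | P a b => simp at h
  | X a b e f =>
    obtain ⟨⟨n, R'⟩, hq, h⟩ := List.mem_filterMap.1 h
    have hpq := rearranged_of_mem_picks₂ hp hq
    cases n with
    | P a b => simp at h
    | X a' g h' b' =>
      simp only [Bool.cond_eq_ite, Bool.and_eq_true, Nat.beq_eq] at h
      split_ifs at h with h1
      obtain ⟨rfl, rfl⟩ := h1
      obtain rfl := Option.some_injective _ h
      exact ⟨_, hpq, .r2 _ _ _ _ _ _ _⟩

lemma rearrangedMove_of_mem_r3Results {D E : PDCode} (h : E ∈ r3Results D) :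
    RearrangedMove D E := by
  obtain ⟨⟨n, R⟩, hp, h⟩ := List.mem_flatMap.1 h
  cases n with
  | P a b => simp at h
  | X u₀ u₂ x₀ y₂ =>
    obtain ⟨⟨n, R'⟩, hq, h⟩ := List.mem_flatMap.1 h
    cases n with
    | P a b => simp at h
    | X a b c d =>
      simp only [Bool.cond_eq_ite, Bool.and_eq_true, Nat.beq_eq] at h
      split_ifs at h with h1 h2
      · obtain ⟨⟨n, R''⟩, hr, h⟩ := List.mem_filterMap.1 h
        have hpqr := rearranged_of_mem_picks₃ hp hq hr
        cases n with
        | P a b => simp at h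
        | X y₁ u₂' u₁ x₂ =>
          simp only at h
          split_ifs at h with h3
          obtain ⟨rfl, rfl⟩ := h3
          subst h1
          obtain rfl := Option.some_injective _ h
          exact ⟨_, hpqr, .r3 _ _ _ _ _ _ _ _ _ _⟩
      · obtain ⟨⟨n, R''⟩, hr, h⟩ := List.mem_filterMap.1 h
        have hpqr := rearranged_of_mem_picks₃ hp hq hr
        cases n with
        | P a b => simp at h
        | X y₁ u₂' u₁ x₂ =>
          simp only at h
          split_ifs at h with h3
          obtain ⟨rfl, rfl⟩ := h3
          subst h2
          obtain rfl := Option.some_injective _ h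
          exact ⟨_, hpqr, .r3_switched _ _ _ _ _ _ _ _ _ _⟩
      · simp at h

/-- Remove up to `n` marked points at the front of the code, and check that all codes on the way are
knot diagrams. -/
def unmarkAll : ℕ → PDCode → Option PDCode
  | n + 1, .P a b :: D =>
    bif isKnot (.P a b :: D) && !(Nat.beq a b) then unmarkAll n (D.map (Node.subst b a)) else none
  | _, D => bif isKnot D then some D else none

lemma sameKnot_of_unmarkAll {n : ℕ} {D E : PDCode} (h : unmarkAll n D = some E) :
    D.IsKnotDiagram ∧ E.IsKnotDiagram ∧ SameKnot D E := by
  fun_induction unmarkAll n D with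
  | case1 n a b D hD ih =>
    rw [Bool.and_eq_true] at hD
    obtain ⟨hDE, hE, hs⟩ := ih h
    have hab : a ≠ b := by rintro rfl; simp at hD
    have hD := isKnotDiagram_of_isKnot hD.1
    refine ⟨hD, hE, (SameKnot.of_move hD hDE ?_).trans hs⟩
    rw [Node.subst_eq]
    exact .unmark D a b hab
  | case3 n D hD _ =>
    obtain rfl := Option.some_injective _ h
    exact ⟨isKnotDiagram_of_isKnot hD, isKnotDiagram_of_isKnot hD, SameKnot.refl _⟩
  | case2 | case4 => simp at h

/-- Remove one or two crossings by a first or a second Reidemeister move. -/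
def shrink (D : PDCode) : Option PDCode := (r1Results D ++ r2Results D).findSome? (unmarkAll 2)

lemma sameKnot_of_shrink {D E : PDCode} (hD : D.IsKnotDiagram) (h : shrink D = some E) :
    E.IsKnotDiagram ∧ SameKnot D E := by
  obtain ⟨D', hD', h⟩ := List.exists_of_findSome?_eq_some h
  obtain ⟨hk, hE, hs⟩ := sameKnot_of_unmarkAll h
  refine ⟨hE, (RearrangedMove.sameKnot ?_ hD hk).trans hs⟩
  rcases List.mem_append.1 hD' with h | h
  · exact rearrangedMove_of_mem_r1Results h
  · exact rearrangedMove_of_mem_r2Results h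

/-- Remove one or two crossings, if necessary after a third Reidemeister move. -/
def simplifyStep (D : PDCode) : Option PDCode :=
  match shrink D with
  | some E => some E
  | none => (r3Results D).findSome? fun E => bif isKnot E then shrink E else none

lemma sameKnot_of_simplifyStep {D E : PDCode} (hD : D.IsKnotDiagram)
    (h : simplifyStep D = some E) : E.IsKnotDiagram ∧ SameKnot D E := by
  unfold simplifyStep at h
  split at h
  next E' hE' =>
    obtain rfl := Option.some_injective _ h
    exact sameKnot_of_shrink hD hE'
  next =>
    obtain ⟨D', hD', h⟩ := List.exists_of_findSome?_eq_some h
    rw [Bool.cond_eq_ite] at h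
    split_ifs at h with hk
    have hk := isKnotDiagram_of_isKnot hk
    obtain ⟨hE, hs⟩ := sameKnot_of_shrink hk h
    exact ⟨hE, ((rearrangedMove_of_mem_r3Results hD').sameKnot hD hk).trans hs⟩

/-- Simplify a diagram by at most `n` steps. -/
def simplify : ℕ → PDCode → PDCode
  | 0, D => D
  | n + 1, D => match simplifyStep D with
    | some E => simplify n E
    | none => D

lemma sameKnot_simplify (n : ℕ) {D : PDCode} (hD : D.IsKnotDiagram) :
    (simplify n D).IsKnotDiagram ∧ SameKnot D (simplify n D) := by
  induction n generalizing D with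
  | zero => exact ⟨hD, SameKnot.refl _⟩
  | succ n ih =>
    rw [simplify]
    split
    next E hE =>
      obtain ⟨hE, hs⟩ := sameKnot_of_simplifyStep hD hE
      obtain ⟨hF, hs'⟩ := ih hE
      exact ⟨hF, hs.trans hs'⟩
    next => exact ⟨hD, SameKnot.refl _⟩

/-! ### Comparing codes of diagrams -/

/-- The labels met on the first `n` edges of a journey along the knot that starts at the end `y`. -/
def walkLabels (L P O : ℕ) : ℕ → ℕ → List ℕ
  | 0, _ => []
  | n + 1, y => entry L y :: walkLabels L P O n (entry O (entry P y))

/-- The labels of a diagram in the order in which they are met from the end number `s` on. -/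
def strandLabels (D : PDCode) (s : ℕ) : List ℕ :=
  let t := endTable 0 D
  walkLabels (tabulate (·.label) t) (partners t) (tabulate (·.opposite) t) (t.length / 2) s

/-- Rename the labels in the list `t` to their positions. -/
def newName (t : List ℕ) (x : ℕ) : ℕ := if x ∈ t then t.idxOf x else t.length + x

lemma newName_injective (t : List ℕ) : Function.Injective (newName t) := by
  intro x y h
  unfold newName at h
  split_ifs at h with hx hy hy
  · exact List.idxOf_inj hx |>.1 h
  · have := List.idxOf_lt_length_iff.2 hx; omega
  · have := List.idxOf_lt_length_iff.2 hy; omega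
  · omega

/-- Read off a crossing from that under-crossing end which has the smaller label. -/
def Node.upright : Node → Node
  | .X a b c d => bif Nat.ble a c then .X a b c d else .X c d a b
  | .P a b => .P a b

lemma rearranged_upright (D : PDCode) : Rearranged D (D.map Node.upright) := by
  induction D with
  | nil => exact .refl
  | cons n D ih =>
    refine Relation.ReflTransGen.trans (ih.cons n) ?_
    cases n with
    | X a b c d =>
      simp only [List.map_cons, Node.upright]
      cases Nat.ble a c
      · exact rearranged_turned _ _
      · exact .refl
    | P a b => exact .refl

/-- The code of a diagram in which the labels are the numbers of the edges in the order in which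
they are met from the end number `s` on. -/
def normalCode (D : PDCode) (s : ℕ) : PDCode :=
  (D.map (Node.relabel (newName (strandLabels D s)))).map Node.upright

lemma sameKnot_normalCode {D : PDCode} (hD : D.IsKnotDiagram) (s : ℕ) :
    (normalCode D s).IsKnotDiagram ∧ SameKnot D (normalCode D s) := by
  have hinj := newName_injective (strandLabels D s)
  have hE := (similar_relabel (newName (strandLabels D s)) D).isKnotDiagram hinj hD
  obtain ⟨hF, hs⟩ := (rearranged_upright _).sameKnot hE
  exact ⟨hF, (SameKnot.of_move hD hE (.rename D _ hinj)).trans hs⟩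

/-- A test whether two codes describe the same diagram on the sphere: the end number `0` of `T`, at
an under-crossing, may correspond to any end of `D` at an under-crossing. -/
def sameDiagram (D T : PDCode) : Bool :=
  (List.range (2 * D.length)).any fun s => (normalCode D (2 * s)).isPerm (normalCode T 0)

lemma sameKnot_of_sameDiagram {D T : PDCode} (hD : D.IsKnotDiagram) (hT : T.IsKnotDiagram)
    (h : sameDiagram D T) : SameKnot D T := by
  obtain ⟨s, -, hs⟩ := List.any_eq_true.1 h
  rw [List.isPerm_iff] at hs
  obtain ⟨hD', h1⟩ := sameKnot_normalCode hD (2 * s)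
  obtain ⟨hT', h2⟩ := sameKnot_normalCode hT 0
  exact (h1.trans (.of_move hD' hT' (.reorder hs))).trans h2.symm

/-- A test whether the diagram `D` is the diagram `T` or its mirror image. -/
def sameDiagramUpToMirror (D T : PDCode) : Bool :=
  (isKnot T && sameDiagram D T) || (isKnot T.mirror && sameDiagram D T.mirror)

lemma sameKnot_of_sameDiagramUpToMirror {D T : PDCode} (hD : D.IsKnotDiagram)
    (h : sameDiagramUpToMirror D T) : SameKnot D T ∨ SameKnot D T.mirror := by
  simp only [sameDiagramUpToMirror, Bool.or_eq_true, Bool.and_eq_true] at h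
  exact h.imp (fun h => sameKnot_of_sameDiagram hD (isKnotDiagram_of_isKnot h.1) h.2)
    fun h => sameKnot_of_sameDiagram hD (isKnotDiagram_of_isKnot h.1) h.2

/-! ### Computing reductions of words -/

instance (f : List TieMove) : Decidable (IsAlternatingLR f) := by
  unfold IsAlternatingLR; infer_instance

/-- The move given by a letter, if it is a tie move. -/
def Letter.move? : Letter → Option TieMove
  | .move s => some s
  | _ => none

/-- The results of the reductions of the word of a tie sequence. -/
def tieReducts (m : List TieMove) : List (List Letter) :=
  let u := m.take (m.length - 4)
  (if m = [Lo, Ri, Co] then [[]] else []) ++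
  (if m = u ++ [Li, Ro, Li, Co] then [(u ++ [Li, Co]).map .move ++ [.t₁]] else []) ++
  (if m = u ++ [Ri, Lo, Ri, Co] then [(u ++ [Ri, Co]).map .move ++ [.t₁]] else []) ++
  (if m = u ++ [Ci, Ro, Li, Co] then [u.map .move] else []) ++
  (if m = u ++ [Ci, Lo, Ri, Co] then [u.map .move] else [])

/-- The results of the reductions of a word that consists of tie moves only. -/
def moveReducts (f : List TieMove) : List (List Letter) :=
  (if IsAlternatingLR f then [[]] else []) ++
  (List.range f.length).filterMap fun i => match f.drop i with
    | c :: s :: g => if c.1 = .C ∧ IsAlternatingLR (s :: g) then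
        some ((f.take i ++ [c, s]).map .move) else none
    | _ => none

/-- The results of the reductions of a word that shorten it. -/
def reducts (w : List Letter) : List (List Letter) :=
  let f := w.filterMap Letter.move?
  ((if w = tieWord f then tieReducts f else []) ++
    if w = f.map .move then moveReducts f else []).filter fun v => v.length < w.length

lemma filterMap_map_move (f : List TieMove) : (f.map .move).filterMap Letter.move? = f := by
  simp [List.filterMap_map, Function.comp_def, Letter.move?]

lemma filterMap_tieWord (m : List TieMove) : (tieWord m).filterMap Letter.move? = m := by
  rw [tieWord, List.filterMap_append, filterMap_map_move]
  simp [Letter.move?]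

lemma reduction_of_mem_tieReducts {m : List TieMove} {v : List Letter} (h : v ∈ tieReducts m) :
    Reduction (tieWord m) v := by
  simp only [tieReducts, List.mem_append, List.mem_ite_nil_right, List.mem_singleton] at h
  rcases h with (((⟨h, rfl⟩ | ⟨h, rfl⟩) | ⟨h, rfl⟩) | ⟨h, rfl⟩) | ⟨h, rfl⟩
  · subst h; exact .zero
  · have := Reduction.one_left (m.take (m.length - 4)); rwa [← h] at this
  · have := Reduction.one_right (m.take (m.length - 4)); rwa [← h] at this
  · have := Reduction.two_left (m.take (m.length - 4)); rwa [← h] at this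
  · have := Reduction.two_right (m.take (m.length - 4)); rwa [← h] at this

lemma reduction_of_mem_moveReducts {f : List TieMove} {v : List Letter} (h : v ∈ moveReducts f) :
    Reduction (f.map .move) v := by
  simp only [moveReducts, List.mem_append, List.mem_ite_nil_right, List.mem_singleton,
    List.mem_filterMap] at h
  rcases h with ⟨h, rfl⟩ | ⟨i, -, h⟩
  · exact .three f h
  · split at h
    next c s g hi =>
      split_ifs at h with hc
      obtain rfl := Option.some_injective _ h
      have := Reduction.four (f.take i) c s g hc.1 hc.2
      rwa [← hi, List.take_append_drop] at this
    next => simp at h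

lemma reduction_of_mem_reducts {w v : List Letter} (h : v ∈ reducts w) : Reduction w v := by
  simp only [reducts, List.mem_filter, List.mem_append, List.mem_ite_nil_right] at h
  rcases h.1 with ⟨hw, h⟩ | ⟨hw, h⟩
  · rw [hw]; exact reduction_of_mem_tieReducts h
  · rw [hw]; exact reduction_of_mem_moveReducts h

lemma mem_reducts_of_mem_tieReducts {m : List TieMove} {v : List Letter} (h : v ∈ tieReducts m)
    (hv : v.length < (tieWord m).length) : v ∈ reducts (tieWord m) := by
  simp only [reducts, filterMap_tieWord, List.mem_filter, List.mem_append]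
  exact ⟨.inl (by simpa using h), by simpa using hv⟩

lemma mem_reducts_of_mem_moveReducts {f : List TieMove} {v : List Letter} (h : v ∈ moveReducts f)
    (hv : v.length < f.length) : v ∈ reducts (f.map .move) := by
  simp only [reducts, filterMap_map_move, List.mem_filter, List.mem_append]
  exact ⟨.inr (by simpa using h), by simpa using hv⟩

lemma Reduction.mem_reducts {w v : List Letter} (h : Reduction w v) : v = w ∨ v ∈ reducts w := by
  cases h with
  | zero => exact .inr (by decide)
  | one_left u =>
    exact .inr (mem_reducts_of_mem_tieReducts (by simp [tieReducts]) (by simp [tieWord]))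
  | one_right u =>
    exact .inr (mem_reducts_of_mem_tieReducts (by simp [tieReducts]) (by simp [tieWord]))
  | two_left u =>
    exact .inr (mem_reducts_of_mem_tieReducts (by simp [tieReducts])
      (by simp [tieWord]))
  | two_right u =>
    exact .inr (mem_reducts_of_mem_tieReducts (by simp [tieReducts])
      (by simp [tieWord]))
  | three f hf =>
    rcases f with _ | ⟨s, f⟩
    · exact .inl rfl
    · exact .inr (mem_reducts_of_mem_moveReducts (by simp [moveReducts, hf]) (by simp))
  | four u c s f hc hf =>
    rcases f with _ | ⟨t, f⟩
    · exact .inl rfl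
    · refine .inr (mem_reducts_of_mem_moveReducts ?_ (by simp))
      refine List.mem_append_right _ (List.mem_filterMap.2 ⟨u.length, by simp, ?_⟩)
      simp [hc, hf]

/-- The words to which `w` reduces by at most `k` shortening reductions. -/
def reachable : ℕ → List Letter → List (List Letter)
  | 0, w => [w]
  | k + 1, w => w :: (reducts w).flatMap (reachable k)

lemma self_mem_reachable (k : ℕ) (w : List Letter) : w ∈ reachable k w := by
  cases k <;> simp [reachable]

lemma reducesTo_of_mem_reachable {k : ℕ} {w v : List Letter} (h : v ∈ reachable k w) :
    ReducesTo w v := by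
  induction k generalizing w with
  | zero => obtain rfl := List.mem_singleton.1 h; exact .refl
  | succ k ih =>
    rcases List.mem_cons.1 h with rfl | h
    · exact .refl
    · obtain ⟨x, hx, h⟩ := List.mem_flatMap.1 h
      exact .head (reduction_of_mem_reducts hx) (ih h)

lemma ReducesTo.mem_reachable {w v : List Letter} (h : ReducesTo w v) {k : ℕ}
    (hk : w.length ≤ k) : v ∈ reachable k w := by
  induction h using Relation.ReflTransGen.head_induction_on generalizing k with
  | refl => exact self_mem_reachable k v
  | head h _ ih =>
    rcases h.mem_reducts with rfl | hx
    · exact ih hk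
    · have hlt := of_decide_eq_true (List.mem_filter.1 hx).2
      cases k with
      | zero => omega
      | succ k => exact List.mem_cons_of_mem _ (List.mem_flatMap.2 ⟨_, hx, ih (by omega)⟩)

/-- The words to which a tie sequence reduces. -/
def reducedWords (m : List TieMove) : List (List Letter) := reachable (m.length + 1) (tieWord m)

lemma mem_reducedWords {m : List TieMove} {v : List Letter} :
    v ∈ reducedWords m ↔ ReducesTo (tieWord m) v :=
  ⟨reducesTo_of_mem_reachable, fun h => h.mem_reachable (by simp [tieWord])⟩

/-! ### Recognizing the types of words -/

/-- The region given by a letter, if it is a tie move. -/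
def Letter.region? : Letter → Option Region
  | .move s => some s.1
  | _ => none

/-- The letter may stand for `∗`. -/
def Letter.isStar : Letter → Bool
  | .move (.C, _) => false
  | .move _ => true
  | .T => false
  | .t₁ => true

lemma Letter.isStar_iff (x : Letter) :
    x.isStar ↔ x = .t₁ ∨ ∃ d, x = .move (.L, d) ∨ x = .move (.R, d) := by
  rcases x with ⟨r, d⟩ | _ | _
  · cases r <;> simp [isStar]
  · simp [isStar]
  · simp [isStar]

lemma map_region?_eq_iff {w : List Letter} {r : List Region} :
    w.map Letter.region? = r.map some ↔
      ∃ u : List TieMove, w = u.map .move ∧ u.map Prod.fst = r := by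
  constructor
  · intro h
    induction w generalizing r with
    | nil =>
      cases r with
      | nil => exact ⟨[], rfl, rfl⟩
      | cons => simp at h
    | cons x w ih =>
      cases r with
      | nil => simp at h
      | cons s r =>
        rw [List.map_cons, List.map_cons, List.cons.injEq] at h
        obtain ⟨u, rfl, rfl⟩ := ih h.2
        cases x with
        | move t => exact ⟨t :: u, rfl, by simpa [Letter.region?] using h.1⟩
        | T | t₁ => simp [Letter.region?] at h
  · rintro ⟨u, rfl, rfl⟩
    simp [Letter.region?]

/-- A test for `HasForm r v`. -/
def hasForm (r : List Region) (v : List Letter) : Bool :=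
  v.dropLast.map Letter.region? == r.map some && v.getLast?.any Letter.isStar

lemma hasForm_iff (r : List Region) (v : List Letter) : hasForm r v ↔ HasForm r v := by
  simp only [hasForm, Bool.and_eq_true, beq_iff_eq, map_region?_eq_iff, Option.any_eq_true,
    Letter.isStar_iff]
  constructor
  · rintro ⟨⟨u, hu, hr⟩, x, hx, hs⟩
    exact ⟨u, x, by rw [← hu, List.dropLast_append_getLast? x hx], hr, hs⟩
  · rintro ⟨u, x, rfl, hr, hs⟩
    exact ⟨⟨u, by simp, hr⟩, x, by simp, hs⟩

lemma HasForm.length_eq {r : List Region} {v : List Letter} (h : HasForm r v) :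
    v.length = r.length + 1 := by
  obtain ⟨u, x, rfl, rfl, -⟩ := h
  simp

lemma length_alternatingLR (n : ℕ) : (alternatingLR n).length = n := by simp [alternatingLR]

lemma length_repeatPair (r s : Region) (k : ℕ) : (repeatPair r s k).length = 2 * k := by
  simp [repeatPair, mul_comm]

lemma isType1_iff (v : List Letter) :
    IsType1 v ↔ 3 ≤ v.length ∧ hasForm (alternatingLR (v.length - 2) ++ [.C]) v := by
  rw [hasForm_iff]
  constructor
  · rintro ⟨n, hn, h⟩
    have hl := h.length_eq
    simp only [List.length_append, length_alternatingLR, List.length_singleton] at hl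
    refine ⟨by omega, ?_⟩
    rwa [show v.length - 2 = n by omega]
  · rintro ⟨hl, h⟩
    exact ⟨_, by omega, h⟩

lemma hasForm_repeat_length {l : List Region} {r s : Region} {k : ℕ} {v : List Letter}
    (h : HasForm (l ++ repeatPair r s k) v) : v.length = l.length + 2 * k + 1 := by
  rw [h.length_eq, List.length_append, length_repeatPair]

/-- In a word of the form `l (r s … r s) ∗`, the length determines the number of repetitions. -/
lemma exists_hasForm_repeat_iff (l : List Region) (r s : Region) (v : List Letter) :
    (∃ k, HasForm (l ++ repeatPair r s k) v) ↔
      hasForm (l ++ repeatPair r s ((v.length - (l.length + 1)) / 2)) v := by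
  rw [hasForm_iff]
  constructor
  · rintro ⟨k, h⟩
    have hl := hasForm_repeat_length h
    rwa [show (v.length - (l.length + 1)) / 2 = k by omega]
  · exact fun h => ⟨_, h⟩

instance : DecidablePred IsType1 := fun v => decidable_of_iff _ (isType1_iff v).symm
instance : DecidablePred IsType2 := fun v =>
  decidable_of_iff _ (exists_hasForm_repeat_iff [.L, .R, .C] .R .C v).symm
instance : DecidablePred IsType3 := fun v =>
  decidable_of_iff _ (exists_hasForm_repeat_iff [.L, .C] .R .C v).symm
instance : DecidablePred IsTorusType := fun v =>
  decidable_of_iff _ (exists_hasForm_repeat_iff [.L, .C] .L .C v).symm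

/-- The word `v` is of the type that belongs to the twist knot with `n` twists. -/
def IsTwistWord (n : ℕ) (v : List Letter) : Prop :=
  v.length = n + 2 ∧ (IsType1 v ∨ (Even n ∧ IsType2 v) ∨ (Odd n ∧ IsType3 v))

instance (n : ℕ) : DecidablePred (IsTwistWord n) := fun v => by
  unfold IsTwistWord; infer_instance

/-- Words of types 2 and 3 automatically have a length of the right parity. -/
lemma exists_isTwistWord_iff (v : List Letter) :
    (∃ n, 1 ≤ n ∧ IsTwistWord n v) ↔ IsType1 v ∨ IsType2 v ∨ IsType3 v := by
  constructor
  · rintro ⟨n, -, -, h⟩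
    exact h.imp id (Or.imp And.right And.right)
  · rintro (h | h | h)
    · have := ((isType1_iff v).1 h).1
      exact ⟨v.length - 2, by omega, by omega, .inl h⟩
    · obtain ⟨k, hk⟩ := id h
      have := hasForm_repeat_length hk
      simp only [List.length_cons, List.length_nil] at this
      exact ⟨v.length - 2, by omega, by omega, .inr (.inl ⟨⟨k + 1, by omega⟩, h⟩)⟩
    · obtain ⟨k, hk⟩ := id h
      have := hasForm_repeat_length hk
      simp only [List.length_cons, List.length_nil] at this
      exact ⟨v.length - 2, by omega, by omega, .inr (.inr ⟨⟨k, by omega⟩, h⟩)⟩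

/-! ### The list of all tie sequences -/

/-- The moves that may follow a move. -/
def TieMove.next (s : TieMove) : List TieMove :=
  [Li, Lo, Ri, Ro, Ci, Co].filter fun t => s.1 ≠ t.1 ∧ s.2 ≠ t.2

/-- All lists of `n` moves that may follow a move. -/
def extensions : ℕ → TieMove → List (List TieMove)
  | 0, _ => [[]]
  | n + 1, s => (TieMove.next s).flatMap fun t => (extensions n t).map (t :: ·)

/-- The list of all tie sequences with `n + 1` moves. -/
def tieSequences (n : ℕ) : List (List TieMove) :=
  ([Li, Lo].flatMap fun s => (extensions n s).map (s :: ·)).filter fun m =>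
    [Lo, Ri, Co].isSuffixOf m || [Ro, Li, Co].isSuffixOf m

lemma TieMove.mem_next {s t : TieMove} (h₁ : s.1 ≠ t.1) (h₂ : s.2 ≠ t.2) : t ∈ next s := by
  refine List.mem_filter.2 ⟨?_, by simp [h₁, h₂]⟩
  obtain ⟨r, d⟩ := t
  cases r <;> cases d <;> decide

lemma mem_extensions {s : TieMove} {m : List TieMove}
    (h₁ : (s :: m).IsChain (fun s t => s.1 ≠ t.1)) (h₂ : (s :: m).IsChain (fun s t => s.2 ≠ t.2)) :
    m ∈ extensions m.length s := by
  induction m generalizing s with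
  | nil => simp [extensions]
  | cons t m ih =>
    rw [List.isChain_cons_cons] at h₁ h₂
    exact List.mem_flatMap.2
      ⟨t, TieMove.mem_next h₁.1 h₂.1, List.mem_map.2 ⟨m, ih h₁.2 h₂.2, rfl⟩⟩

lemma IsTieSequence.mem_tieSequences {m : List TieMove} (hm : IsTieSequence m) :
    ∃ n < 9, m ∈ tieSequences n := by
  obtain _ | ⟨s, m⟩ := m
  · simpa using hm.starts
  · have hshort := hm.short
    refine ⟨m.length, by simpa using hshort, List.mem_filter.2 ⟨List.mem_flatMap.2
      ⟨s, ?_, List.mem_map.2 ⟨m, mem_extensions hm.regions hm.directions, rfl⟩⟩, ?_⟩⟩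
    · simpa using hm.starts
    · simpa using hm.ends

/-! ### Comparing the knots and the words -/

/-- A test for one tie sequence: if the sequence reduces to a word for a twist knot or torus knot,
then its simplified diagram is the standard one, and otherwise the invariants differ. The twist
knots with more than eight twists and the torus knots with more than nine crossings need no test:
the bound on the invariant excludes these knots, and the bound on the lengths of the words excludes
the words that belong to them. -/
def verify (m : List TieMove) : Bool :=
  let E := simplify 12 (tieDiagram m)
  let i := bracketNorm E
  let W := reducedWords m
  isKnot (tieDiagram m) && W.all (fun v => v.length ≤ 10) && decide (|i| < 10 ^ 8) &&
  (List.range 8).all (fun k => bif W.any fun v => IsTwistWord (k + 1) v then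
    sameDiagramUpToMirror E (twistDiagram (k + 1)) else i != twistNorm (k + 1)) &&
  (List.range 4).all (fun k => bif W.any fun v => v.length = 2 * k + 3 ∧ IsTorusType v then
    sameDiagramUpToMirror E (torusDiagram (2 * k + 3)) else i != torusNorm (2 * k + 3))

/-- The kernel evaluates the test, for all tie sequences with at most seven moves. -/
lemma verify_short : (List.range 7).all fun n => (tieSequences n).all verify := by decide +kernel

lemma verify_eight_moves : (tieSequences 7).all verify := by decide +kernel

lemma verify_nine_moves : (tieSequences 8).all verify := by decide +kernel

lemma IsTieSequence.verify {m : List TieMove} (hm : IsTieSequence m) : verify m := by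
  obtain ⟨n, hn, hm⟩ := hm.mem_tieSequences
  have h := List.all_eq_true.1 verify_short n
  have h₇ := List.all_eq_true.1 verify_eight_moves m
  have h₈ := List.all_eq_true.1 verify_nine_moves m
  obtain hn | rfl | rfl : n < 7 ∨ n = 7 ∨ n = 8 := by omega
  · exact List.all_eq_true.1 (h (List.mem_range.2 hn)) m hm
  · exact h₇ hm
  · exact h₈ hm

lemma IsTwistKnotWith.invariant_eq {n : ℕ} (hn : 1 ≤ n) {D : PDCode} (h : IsTwistKnotWith n D) :
    invariant D = twistNorm n := by
  rw [← invariant_twistDiagram hn]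
  rcases h with h | h
  · exact h.invariant_eq
  · rw [h.invariant_eq, invariant_mirror]

lemma IsTorusKnotTwo.invariant_eq {p : ℕ} (hp : 2 ≤ p) {D : PDCode} (h : IsTorusKnotTwo p D) :
    invariant D = torusNorm p := by
  rw [← invariant_torusDiagram hp]
  rcases h with h | h
  · exact h.invariant_eq
  · rw [h.invariant_eq, invariant_mirror]

/-- What `verify` shows: up to the bounds that the sizes of the invariant and of the words impose,
the words tell which knots occur and the invariant excludes the others. -/
lemma IsTieSequence.exists_invariant {m : List TieMove} (hm : IsTieSequence m) :
    ∃ i : ℤ, invariant (tieDiagram m) = i ∧ |i| < 10 ^ 8 ∧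
      (∀ v, ReducesTo (tieWord m) v → v.length ≤ 10) ∧
      (∀ n, 1 ≤ n → n ≤ 8 →
        ((∃ v, ReducesTo (tieWord m) v ∧ IsTwistWord n v) → IsTwistKnotWith n (tieDiagram m)) ∧
        (i = twistNorm n → ∃ v, ReducesTo (tieWord m) v ∧ IsTwistWord n v)) ∧
      (∀ p, 3 ≤ p → p ≤ 9 → Odd p →
        ((∃ v, ReducesTo (tieWord m) v ∧ v.length = p ∧ IsTorusType v) →
          IsTorusKnotTwo p (tieDiagram m)) ∧
        (i = torusNorm p → ∃ v, ReducesTo (tieWord m) v ∧ v.length = p ∧ IsTorusType v)) := by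
  have h := hm.verify
  simp only [TieKnot.verify, Bool.and_eq_true, List.all_eq_true, List.mem_range, decide_eq_true_eq,
    Bool.cond_eq_ite, mem_reducedWords] at h
  obtain ⟨⟨⟨⟨hknot, hlen⟩, hi⟩, htwist⟩, htorus⟩ := h
  have hknot := isKnotDiagram_of_isKnot hknot
  obtain ⟨hE, hsame⟩ := sameKnot_simplify 12 hknot
  refine ⟨_, hsame.invariant_eq.trans (invariant_eq_bracketNorm _), hi, hlen, fun n hn hn' => ?_,
    fun p hp hp' hodd => ?_⟩
  · have h := htwist (n - 1) (by omega)
    rw [Nat.sub_add_cancel hn] at h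
    split_ifs at h with hv <;>
      simp only [List.any_eq_true, decide_eq_true_eq, mem_reducedWords] at hv
    · exact ⟨fun _ => (sameKnot_of_sameDiagramUpToMirror hE h).imp hsame.trans hsame.trans,
        fun _ => hv⟩
    · exact ⟨fun hv' => absurd hv' hv, fun hi' => absurd hi' (by simpa using h)⟩
  · obtain ⟨k, rfl⟩ : ∃ k, p = 2 * k + 3 := by obtain ⟨k, rfl⟩ := hodd; exact ⟨k - 1, by omega⟩
    have h := htorus k (by omega)
    split_ifs at h with hv <;>
      simp only [List.any_eq_true, decide_eq_true_eq, mem_reducedWords] at hv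
    · exact ⟨fun _ => (sameKnot_of_sameDiagramUpToMirror hE h).imp hsame.trans hsame.trans,
        fun _ => hv⟩
    · exact ⟨fun hv' => absurd hv' hv, fun hi' => absurd hi' (by simpa using h)⟩

lemma IsTieSequence.isTwistKnotWith_iff {m : List TieMove} (hm : IsTieSequence m) {n : ℕ}
    (hn : 1 ≤ n) : IsTwistKnotWith n (tieDiagram m) ↔
      ∃ v, ReducesTo (tieWord m) v ∧ IsTwistWord n v := by
  obtain ⟨i, hi, hsmall, hlen, h, -⟩ := hm.exists_invariant
  constructor
  · intro hK
    have heq : i = twistNorm n := by exact_mod_cast hi.symm.trans (hK.invariant_eq hn)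
    have hn' : n < 7 := by
      by_contra! hn'
      exact absurd (le_abs_twistNorm hn') (by rw [← heq]; exact hsmall.not_ge)
    exact (h n hn (by omega)).2 heq
  · rintro ⟨v, hv, hword⟩
    exact (h n hn (by have := hlen v hv; have := hword.1; omega)).1 ⟨v, hv, hword⟩

lemma IsTieSequence.isTorusKnotTwo_iff {m : List TieMove} (hm : IsTieSequence m) {p : ℕ}
    (hp : 3 ≤ p) (hodd : Odd p) : IsTorusKnotTwo p (tieDiagram m) ↔
      ∃ v, ReducesTo (tieWord m) v ∧ v.length = p ∧ IsTorusType v := by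
  obtain ⟨i, hi, hsmall, hlen, -, h⟩ := hm.exists_invariant
  constructor
  · intro hK
    have heq : i = torusNorm p := by
      exact_mod_cast hi.symm.trans (hK.invariant_eq (by omega : 2 ≤ p))
    have hp' : p < 9 := by
      by_contra! hp'
      exact absurd (le_abs_torusNorm hp') (by rw [← heq]; exact hsmall.not_ge)
    exact (h p hp (by omega) hodd).2 heq
  · rintro ⟨v, hv, hlength, htype⟩
    have hp' : p ≤ 9 := by have := hlen v hv; obtain ⟨k, rfl⟩ := hodd; omega
    exact (h p hp hp' hodd).1 ⟨v, hv, hlength, htype⟩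

end TieKnot

theorem mainTheorem12 (m : List TieKnot.TieMove) (hm : TieKnot.IsTieSequence m) :
    (TieKnot.IsTwistKnot (TieKnot.tieDiagram m) ↔
      ∃ v, TieKnot.ReducesTo (TieKnot.tieWord m) v ∧
        (TieKnot.IsType1 v ∨ TieKnot.IsType2 v ∨ TieKnot.IsType3 v)) ∧
    (∀ n : ℕ, 1 ≤ n →
      (TieKnot.IsTwistKnotWith n (TieKnot.tieDiagram m) ↔
        ∃ v, TieKnot.ReducesTo (TieKnot.tieWord m) v ∧ v.length = n + 2 ∧
          (TieKnot.IsType1 v ∨ (Even n ∧ TieKnot.IsType2 v) ∨ (Odd n ∧ TieKnot.IsType3 v)))) ∧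
    (∀ p : ℕ, 3 ≤ p → Odd p →
      (TieKnot.IsTorusKnotTwo p (TieKnot.tieDiagram m) ↔
        ∃ v, TieKnot.ReducesTo (TieKnot.tieWord m) v ∧ v.length = p ∧
          TieKnot.IsTorusType v)) := by
  refine ⟨?_, fun n hn => hm.isTwistKnotWith_iff hn, fun p hp hodd => hm.isTorusKnotTwo_iff hp hodd⟩
  simp only [← TieKnot.exists_isTwistWord_iff]
  constructor
  · rintro ⟨n, hn, hK⟩
    obtain ⟨v, hv, hword⟩ := (hm.isTwistKnotWith_iff hn).1 hK
    exact ⟨v, hv, n, hn, hword⟩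
  · rintro ⟨v, hv, n, hn, hword⟩
    exact ⟨n, hn, (hm.isTwistKnotWith_iff hn).2 ⟨v, hv, hword⟩⟩
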